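/- All digraphs are finite, without loops and without multiple arcs (opposite arcs $xy$ and $yx$ may both be present). For a digraph $D$, $d^+(x)$ and $d^-(x)$ denote the out-degree and in-degree of a vertex $x$, and $d(x)=d^+(x)+d^-(x)$. Two distinct vertices $x,y$ are nonadjacent if neither $xy$ nor $yx$ is an arc. A directed cycle has distinct vertices and length at least $2$. For a set $Y$ of vertices, $D$ is $Y$-strongly connected if for any two distinct $x,y\in Y$ there is a directed path in $D$ from $x$ to $y$. If $D$ has order $n$ (that is, $n$ vertices), then $Y$ satisfies condition $A_0$ if for all triples of distinct vertices $x,y,z\in Y$ with $x$ and $y$ nonadjacent the following two implications hold: (1) if $xz$ is not an arc, then $d(x)+d(y)+d^+(x)+d^-(z)\ge 3n-2$; (2) if $zx$ is not an arc, then $d(x)+d(y)+d^-(x)+d^+(z)\ge 3n-2$. **Theorem.** Let $D$ be a digraph and let $Y$ be a set of vertices of $D$ with $|Y|\ge 2$. Suppose that $D$ is $Y$-strongly connected and that $Y$ satisfies condition $A_0$. Then $D$ has a directed cycle through all vertices of $Y$ except possibly one; that is, there are a vertex $v\in Y$ and a directed cycle of $D$ that contains every vertex of $Y\setminus\{v\}$.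 Moreover, "except possibly one" cannot be dropped: for every $n\ge 4$ there are a digraph $D$ of order $n$ and a set $Y$ of at least two vertices of $D$ such that $D$ is $Y$-strongly connected and $Y$ satisfies condition $A_0$, but $D$ has no directed cycle through all vertices of $Y$. -/

import Mathlib

namespace Digraph

/-- The digraph has no loops. (Multiple arcs are already excluded, since `Adj` is a relation;
opposite arcs `x → y` and `y → x` may both be present.) -/
def Loopless {V : Type*} (D : Digraph V) : Prop :=
  ∀ v, ¬ D.Adj v v

/-- Two distinct vertices are nonadjacent if there is no arc between them in either direction. -/
def Nonadjacent {V : Type*} (D : Digraph V) (x y : V) : Prop :=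
  x ≠ y ∧ ¬ D.Adj x y ∧ ¬ D.Adj y x

/-- The out-degree `d⁺(x)`. -/
noncomputable def outDeg {V : Type*} (D : Digraph V) (x : V) : ℕ :=
  {y | D.Adj x y}.ncard

/-- The in-degree `d⁻(x)`. -/
noncomputable def inDeg {V : Type*} (D : Digraph V) (x : V) : ℕ :=
  {y | D.Adj y x}.ncard

/-- The degree `d(x) = d⁺(x) + d⁻(x)`. -/
noncomputable def deg {V : Type*} (D : Digraph V) (x : V) : ℕ :=
  D.outDeg x + D.inDeg x

/-- `D` is `Y`-strongly connected: every vertex of `Y` is reachable (by a directed path) from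
every other vertex of `Y`. The paths may use vertices outside `Y`. -/
def StronglyConnectedOn {V : Type*} (D : Digraph V) (Y : Set V) : Prop :=
  ∀ x ∈ Y, ∀ y ∈ Y, x ≠ y → Relation.ReflTransGen D.Adj x y

/-- Condition `A₀`. The inequality `S ≥ 3 n - 2` is written `3 n ≤ S + 2`. -/
def ConditionA0 {V : Type*} [Fintype V] (D : Digraph V) (Y : Set V) : Prop :=
  ∀ x ∈ Y, ∀ y ∈ Y, ∀ z ∈ Y, z ≠ x → z ≠ y → D.Nonadjacent x y →
    (¬ D.Adj x z →
      3 * Fintype.card V ≤ D.deg x + D.deg y + D.outDeg x + D.inDeg z + 2) ∧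
    (¬ D.Adj z x →
      3 * Fintype.card V ≤ D.deg x + D.deg y + D.inDeg x + D.outDeg z + 2)

/-- `c` is a directed cycle of `D`: at least two vertices, all distinct, arranged cyclically, with
an arc from each one to the next (also from the last one to the first). -/
def IsDirectedCycle {V : Type*} (D : Digraph V) (c : Cycle V) : Prop :=
  c.Nontrivial ∧ c.Nodup ∧ c.Chain D.Adj

/-- `D` has a directed cycle that passes through all the vertices of `S`. -/
def HasCycleThrough {V : Type*} (D : Digraph V) (S : Set V) : Prop :=
  ∃ c : Cycle V, D.IsDirectedCycle c ∧ ∀ v ∈ S, v ∈ c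

end Digraph

namespace Digraph

/-! Let `K` be the largest number of vertices of `Y` on a cycle, attained by `C`, and suppose that
`C` misses two vertices of `Y`. Call a nonadjacent pair `x, y` in `Y` bad if `d(x) + d(y) ≤ 2n - 2`.
For a bad pair, condition `A₀` says that `d⁺(x) + d⁻(z) ≥ n` for every third `z ∈ Y` with `xz` not
an arc, and dually; so a vertex lies in at most one bad pair (`Bad.le_deg`). All other steps count
two-step walks `x → w → z` against such degree bounds.

Suppose first that a vertex of `Y` lies on a bypass, a path `u, B, v` off `C` with `u ≠ v` on `C`.
Choose cycle and bypass so that the replaced segment `G` from `u` to `v` has few vertices of `Y`,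
and then `G` and `B` are short. Each `y ∈ Y` on `B` then forms a bad pair with each vertex of `Y` on
`G` that cannot be inserted into the complementary path `v, M, u` (`OptTheta.bad`). By
`multi_insert` and maximality there is such a vertex `g`, and it is unique since bad pairs do not
overlap. Exchanging `G` for `B` gives another cycle with `K` vertices of `Y`, missing `g`, and shows
that `y` is alone on `B`. A second missed vertex `y'` cannot be linked with `y` off the
configuration (`OptTheta.not_jump`), and the degree bounds then force it to be able to replace `y`
on `B`. So `y'` is also bad with `g`: two bad pairs share `g`, a contradiction (`OptTheta.false`).

Without such a bypass, any route from `C` through a missed vertex `y ∈ Y` back to `C` ends where it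
began. If `y` formed no bad pair with the vertices of `Y` on `C`, of which there are at least two
(`exists_cyc_two`), its two-step connections to two of them would give a bypass
(`MaxCyc.exists_bad`). A bad pair `y, x` gives short links from another `z ∈ Y` on `C` to `y`, on to
a second missed `y'`, and on to `x`: again a bypass (`MaxCyc.not_bad`). -/

open scoped Classical in
/-- The indicator of an arc. -/
noncomputable def arc {V : Type*} (D : Digraph V) (a b : V) : ℕ := if D.Adj a b then 1 else 0

/-- `D.Link a L b`: the list `L` is the interior of a directed walk from `a` to `b`. -/
def Link {V : Type*} (D : Digraph V) : V → List V → V → Prop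
  | a, [], b => D.Adj a b
  | a, w :: L, b => D.Adj a w ∧ D.Link w L b

/-- `a :: l`, read cyclically, is a directed cycle. -/
def Cyc {V : Type*} (D : Digraph V) (a : V) (l : List V) : Prop :=
  D.Link a l a ∧ (a :: l).Nodup

/-- There are consecutive vertices `c, d` on the walk `a, L, b` with arcs `c → s` and `t → d`. -/
def Ins {V : Type*} (D : Digraph V) (s t : V) : V → List V → V → Prop
  | a, [], b => D.Adj a s ∧ D.Adj t b
  | a, w :: L, b => (D.Adj a s ∧ D.Adj t w) ∨ D.Ins s t w L b

open scoped Classical in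
/-- The number of vertices of `Y` that occur in the list `L`. -/
noncomputable def yc {V : Type*} (Y : Finset V) (L : List V) : ℕ := (Y.filter (· ∈ L)).card

/-- The digraph with all arcs reversed. -/
def rev {V : Type*} (D : Digraph V) : Digraph V := ⟨fun a b => D.Adj b a⟩

/-! ### Walks as lists, insertion of vertices into paths, and counting arcs. -/

section Lists

variable {V : Type*} {D : Digraph V}

@[simp] theorem rev_adj {a b : V} : D.rev.Adj a b ↔ D.Adj b a := Iff.rfl

@[simp] theorem rev_rev : D.rev.rev = D := rfl

@[simp] theorem rev_arc (a b : V) : D.rev.arc a b = D.arc b a := rfl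

theorem arc_le_one (a b : V) : D.arc a b ≤ 1 := by
  unfold arc; split_ifs <;> simp

theorem arc_eq_zero {a b : V} : D.arc a b = 0 ↔ ¬ D.Adj a b := by
  unfold arc; split_ifs <;> simp_all

theorem arc_pos {a b : V} : 0 < D.arc a b ↔ D.Adj a b := by
  unfold arc; split_ifs <;> simp_all

theorem arc_add_arc_le_one {a b c d : V} (h : ¬ (D.Adj a b ∧ D.Adj c d)) :
    D.arc a b + D.arc c d ≤ 1 := by
  unfold arc; split_ifs <;> simp_all

@[simp] theorem link_nil {a b : V} : D.Link a [] b ↔ D.Adj a b := Iff.rfl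

@[simp] theorem link_cons {a b w : V} {L : List V} :
    D.Link a (w :: L) b ↔ D.Adj a w ∧ D.Link w L b := Iff.rfl

@[simp] theorem link_append {a b w : V} {L₁ L₂ : List V} :
    D.Link a (L₁ ++ w :: L₂) b ↔ D.Link a L₁ w ∧ D.Link w L₂ b := by
  induction L₁ generalizing a with
  | nil => simp
  | cons x L ih => simp [ih, and_assoc]

theorem link_rev {a b : V} {L : List V} : D.rev.Link b L.reverse a ↔ D.Link a L b := by
  induction L generalizing a with
  | nil => simp
  | cons x L ih => simp [ih, and_comm]

theorem Ins.suffix {s t a b w : V} {Z L : List V} (h : D.Ins s t w L b) :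
    D.Ins s t a (Z ++ w :: L) b := by
  induction Z generalizing a with
  | nil => exact Or.inr h
  | cons z Z ih => exact Or.inr ih

/-- The last clause is what simultaneous insertion needs: opening the path just before `d` destroys
only that one place, so a vertex `r` without an arc to `d` keeps its own place. -/
theorem Ins.split {s t a b : V} {L : List V} (hi : D.Ins s t a L b) (hl : D.Link a L b) :
    ∃ (L₁ L₂ : List V) (d : V), L = L₁ ++ L₂ ∧ D.Adj t d ∧
      (∀ Z z, (∀ x y, D.Adj x s → D.Adj z y → D.Link x Z y) → D.Adj z d →
        D.Link a (L₁ ++ (Z ++ L₂)) b) ∧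
      (∀ Z r, D.Ins r r a L b → ¬ D.Adj r d → D.Ins r r a (L₁ ++ (Z ++ L₂)) b) := by
  induction L generalizing a with
  | nil =>
    refine ⟨[], [], b, rfl, hi.2, fun Z z hZ hz => ?_, fun Z r hr hd => absurd hr.2 hd⟩
    simpa using hZ a b hi.1 hz
  | cons w L ih =>
    by_cases h : D.Adj a s ∧ D.Adj t w
    · refine ⟨[], w :: L, w, rfl, h.2, fun Z z hZ hz => ?_, fun Z r hr hd => ?_⟩
      · simpa using ⟨hZ a w h.1 hz, hl.2⟩
      · rcases hr with hr | hr
        · exact absurd hr.2 hd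
        · exact hr.suffix
    · obtain ⟨L₁, L₂, d, rfl, h1, h2, h3⟩ := ih (hi.resolve_left h) hl.2
      refine ⟨w :: L₁, L₂, d, rfl, h1, fun Z z hZ hz => ⟨hl.1, h2 Z z hZ hz⟩, fun Z r hr hd => ?_⟩
      rcases hr with hr | hr
      · exact Or.inl hr
      · exact Or.inr (h3 Z r hr hd)

/-- A walk from `s` to `t` can be inserted wherever `s` and `t` have a common partner. -/
theorem Ins.insert {s t a b : V} {L Z : List V} (hi : D.Ins s t a L b) (hl : D.Link a L b)
    (hZ : ∀ x y, D.Adj x s → D.Adj t y → D.Link x Z y) :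
    ∃ L₁ L₂ : List V, L = L₁ ++ L₂ ∧ D.Link a (L₁ ++ (Z ++ L₂)) b := by
  obtain ⟨L₁, L₂, d, h, hd, h2, -⟩ := hi.split hl
  exact ⟨L₁, L₂, h, h2 Z t hZ hd⟩

theorem Ins.prefix {s t a b c : V} {L L' : List V} (h : D.Ins s t a L b) :
    D.Ins s t a (L ++ b :: L') c := by
  induction L generalizing a with
  | nil => exact Or.inl h
  | cons x L ih =>
    rcases h with h | h
    · exact Or.inl h
    · exact Or.inr (ih h)

theorem ins_rev {s t a b : V} {L : List V} (h : D.Ins s t a L b) :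
    D.rev.Ins t s b L.reverse a := by
  induction L generalizing a with
  | nil => exact ⟨h.2, h.1⟩
  | cons w L ih =>
    rw [List.reverse_cons]
    rcases h with h | h
    · exact Ins.suffix (Z := L.reverse) (w := w) (L := []) ⟨h.2, h.1⟩
    · exact (ih h).prefix

theorem exists_last {α : Type*} {p : α → Prop} {L : List α} (h : ∃ x ∈ L, p x) :
    ∃ L₁ x L₂, L = L₁ ++ x :: L₂ ∧ p x ∧ ∀ y ∈ L₂, ¬ p y := by
  induction L with
  | nil => simp at h
  | cons a L ih =>
    by_cases h' : ∃ x ∈ L, p x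
    · obtain ⟨L₁, x, L₂, rfl, hx, hy⟩ := ih h'
      exact ⟨a :: L₁, x, L₂, rfl, hx, hy⟩
    · push Not at h'
      obtain ⟨x, hx, hp⟩ := h
      rcases List.mem_cons.1 hx with rfl | hx
      · exact ⟨[], x, L, rfl, hp, h'⟩
      · exact absurd hp (h' x hx)

/-- Multi-insertion: if every vertex of `S` on the walk `Q` can be inserted into the path `v, M, u`,
then all of them can be inserted simultaneously. -/
theorem multi_insert (S : Set V) (u v : V) : ∀ (k : ℕ) (Q M : List V) (a b : V), Q.length ≤ k →
    D.Link a Q b → D.Link v M u → (v :: (M ++ u :: Q)).Nodup →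
    (∀ s ∈ Q, s ∈ S → D.Ins s s v M u) →
    ∃ M', D.Link v M' u ∧ (v :: (M' ++ [u])).Nodup ∧ (∀ x ∈ M, x ∈ M') ∧
      (∀ x ∈ M', x ∈ M ∨ x ∈ Q) ∧ ∀ s ∈ Q, s ∈ S → s ∈ M' := by
  classical
  intro k
  induction k with
  | zero =>
    intro Q M a b hk _ hM hn _
    obtain rfl : Q = [] := by simpa using hk
    exact ⟨M, hM, hn, by simp, by simp, by simp⟩
  | succ k ih =>
    intro Q M a b hk hQ hM hn hS
    rcases Q with _ | ⟨q, Q⟩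
    · exact ⟨M, hM, hn, by simp, by simp, by simp⟩
    by_cases hq : q ∈ S
    · obtain ⟨L₁, L₂, d, rfl, hqd, hins, hpers⟩ := (hS q (by simp) hq).split hM
      -- With `s` the last vertex of the walk that has an arc to `d`, the whole stretch from `q` to
      -- `s` is inserted before `d`. No later vertex has an arc to `d`, so the places of the later
      -- vertices survive and the induction continues after `s`.
      obtain ⟨Q₁, s, Q₂, hQe, hsd, hlast⟩ :=
        exists_last (p := fun x => D.Adj x d) (L := q :: Q) ⟨q, by simp, hqd⟩
      have hthr : ∀ x y, D.Adj x q → D.Adj s y → D.Link x (Q₁ ++ [s]) y := by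
        intro x y hx hy
        rw [hQe, link_append] at hQ
        rcases Q₁ with _ | ⟨q', Q₁⟩
        · simp only [List.nil_append, List.cons.injEq] at hQe
          obtain ⟨rfl, -⟩ := hQe
          exact ⟨hx, hy⟩
        · simp only [List.cons_append, List.cons.injEq] at hQe
          obtain ⟨rfl, -⟩ := hQe
          rw [link_append]
          exact ⟨⟨hx, hQ.1.2⟩, hy⟩
      have hlen : Q₂.length ≤ k := by
        have := congrArg List.length hQe
        simp at this hk
        omega
      have hn' : (v :: ((L₁ ++ ((Q₁ ++ [s]) ++ L₂)) ++ u :: Q₂)).Nodup := by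
        rw [hQe] at hn
        rw [List.nodup_iff_count_le_one] at hn ⊢
        intro x
        have := hn x
        simp only [List.count_append, List.count_cons, List.count_nil] at this ⊢
        omega
      have hQ2 : ∀ x ∈ Q₂, x ∈ q :: Q := by rw [hQe]; simp +contextual
      obtain ⟨M', h1, h2, h3, h4, h5⟩ := ih Q₂ (L₁ ++ ((Q₁ ++ [s]) ++ L₂)) s b hlen
        (by rw [hQe, link_append] at hQ; exact hQ.2) (hins _ s hthr hsd) hn'
        (fun t ht htS => hpers _ _ (hS t (hQ2 t ht) htS) (hlast t ht))
      refine ⟨M', h1, h2, fun x hx => h3 x ?_, fun x hx => ?_, fun x hx hxS => ?_⟩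
      · simp at hx ⊢; tauto
      · rw [hQe]
        have := h4 x hx
        simp at this ⊢; tauto
      · rw [hQe] at hx
        have h3' := h3 x
        have h5' := h5 x
        simp at hx h3'
        tauto
    · obtain ⟨M', h1, h2, h3, h4, h5⟩ := ih Q M q b (by simpa using hk) hQ.2 hM
        (by
          rw [List.nodup_iff_count_le_one] at hn ⊢
          intro x
          have := hn x
          simp only [List.count_append, List.count_cons] at this ⊢
          omega)
        (fun s hs => hS s (by simp [hs]))
      refine ⟨M', h1, h2, h3, fun x hx => ?_, fun x hx hxS => ?_⟩
      · have := h4 x hx; simp; tauto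
      · rcases List.mem_cons.1 hx with rfl | hx
        · exact absurd hxS hq
        · exact h5 x hx hxS

/-- Each consecutive pair `c, d` carries at most one of the arcs `c → s` and `t → d`. -/
theorem ins_count {s t : V} (a : V) (L : List V) (b : V) (h : ¬ D.Ins s t a L b) :
    ((a :: L).map (D.arc · s)).sum + ((L ++ [b]).map (D.arc t ·)).sum ≤ L.length + 1 := by
  induction L generalizing a with
  | nil => simpa using arc_add_arc_le_one h
  | cons w L ih =>
    have h1 := arc_add_arc_le_one (fun h' => h (Or.inl h'))
    have h2 := ih w (fun h' => h (Or.inr h'))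
    simp only [List.map_cons, List.sum_cons, List.cons_append, List.length_cons] at *
    omega

/-- The closed version of `ins_count`. -/
theorem ins_count_closed {s t : V} (a : V) (L : List V) (h : ¬ D.Ins s t a L a) :
    ((a :: L).map (D.arc · s)).sum + ((a :: L).map (D.arc t ·)).sum ≤ (a :: L).length := by
  have := ins_count a L a h
  simp at *
  omega

theorem sum_map_le {f : V → ℕ} {L : List V} {c : ℕ} (h : ∀ w ∈ L, f w ≤ c) :
    (L.map f).sum ≤ c * L.length := by
  induction L with
  | nil => simp
  | cons a L ih =>
    have := ih (fun w hw => h w (by simp [hw]))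
    have := h a (by simp)
    simp only [List.map_cons, List.sum_cons, List.length_cons]
    linarith

/-- Only the first entry of `L` can contribute to the sum. -/
theorem sum_map_le_one {f : V → ℕ} {L : List V} (h1 : ∀ w, f w ≤ 1)
    (h : ∀ X w Z, L = X ++ w :: Z → X ≠ [] → f w = 0) : (L.map f).sum ≤ 1 := by
  rcases L with _ | ⟨a, L⟩
  · simp
  · have h0 := sum_map_le (f := f) (L := L) (c := 0) (by
      intro w hw
      obtain ⟨X, Z, rfl⟩ := List.append_of_mem hw
      exact (h (a :: X) w Z rfl (by simp)).le)
    have := h1 a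
    simp only [List.map_cons, List.sum_cons]
    omega

/-- The common frame of the degree counts: a configuration `L` is counted by hand and every vertex
off it contributes at most `c`. The additive form avoids truncated subtraction. -/
theorem sum_univ_le [Fintype V] {f : V → ℕ} {L : List V} (hL : L.Nodup) {c : ℕ}
    (h : ∀ w, w ∉ L → f w ≤ c) :
    ∑ w, f w + c * L.length ≤ (L.map f).sum + c * Fintype.card V := by
  classical
  rw [← List.sum_toFinset f hL, ← Finset.sum_add_sum_compl L.toFinset f]
  have h1 : ∑ w ∈ L.toFinsetᶜ, f w ≤ (L.toFinsetᶜ).card * c :=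
    Finset.sum_le_card_nsmul _ _ _ (fun w hw => h w (by simpa using hw))
  have h2 : L.toFinset.card + (L.toFinsetᶜ).card = Fintype.card V := Finset.card_add_card_compl _
  rw [List.toFinset_card_of_nodup hL] at h2
  rw [← h2]
  linarith

theorem outDeg_eq [Fintype V] (x : V) : D.outDeg x = ∑ w, D.arc x w := by
  classical
  simp [outDeg, arc, Set.ncard_eq_toFinset_card']

theorem inDeg_eq [Fintype V] (x : V) : D.inDeg x = ∑ w, D.arc w x := by
  classical
  simp [inDeg, arc, Set.ncard_eq_toFinset_card']

/-- A shortest walk from `a` to the set `S`. -/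
theorem exists_shortest {S : Set V} {a b : V} (ha : a ∉ S) (hb : b ∈ S)
    (h : Relation.ReflTransGen D.Adj a b) :
    ∃ A, ∃ v ∈ S, D.Link a A v ∧ (a :: A).Nodup ∧ (∀ w ∈ A, w ∉ S) ∧
      ∀ A', ∀ v' ∈ S, D.Link a A' v' → A.length ≤ A'.length := by
  classical
  have hex : ∃ k, ∃ A : List V, A.length = k ∧ ∃ v ∈ S, D.Link a A v := by
    rcases Relation.ReflTransGen.cases_head h with rfl | ⟨c, hac, hcb⟩
    · exact absurd hb ha
    · clear h
      induction hcb using Relation.ReflTransGen.head_induction_on generalizing a with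
      | refl => exact ⟨0, [], rfl, b, hb, hac⟩
      | head hcd hdb ih =>
        rename_i c d
        by_cases hc : c ∈ S
        · exact ⟨0, [], rfl, c, hc, hac⟩
        · obtain ⟨k, A, -, v, hv, hA⟩ := ih hc hcd
          exact ⟨_, c :: A, rfl, v, hv, hac, hA⟩
  obtain ⟨A, hAl, v, hv, hA⟩ := Nat.find_spec hex
  have hmin : ∀ A', ∀ v' ∈ S, D.Link a A' v' → A.length ≤ A'.length := fun A' v' hv' h' => by
    rw [hAl]; exact Nat.find_min' hex ⟨A', rfl, v', hv', h'⟩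
  refine ⟨A, v, hv, hA, ?_, ?_, hmin⟩
  · rw [List.nodup_cons]
    refine ⟨fun hm => ?_, ?_⟩
    · obtain ⟨X, Z, rfl⟩ := List.append_of_mem hm
      have := hmin Z v hv (link_append.1 hA).2
      simp at this
      omega
    · by_contra hd
      rw [← List.exists_duplicate_iff_not_nodup] at hd
      obtain ⟨x, hx⟩ := hd
      obtain ⟨X, Z, rfl, hxX, hxZ⟩ : ∃ X Z, A = X ++ Z ∧ x ∈ X ∧ x ∈ Z := by
        rw [List.duplicate_iff_sublist] at hx
        obtain ⟨X, Z, rfl, h1, h2⟩ := List.append_sublist_iff.1 (show List.Sublist ([x] ++ [x]) A from hx)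
        exact ⟨X, Z, rfl, by simpa using h1, by simpa using h2⟩
      obtain ⟨X₁, X₂, rfl⟩ := List.append_of_mem hxX
      obtain ⟨Z₁, Z₂, rfl⟩ := List.append_of_mem hxZ
      have := hmin (X₁ ++ x :: Z₂) v hv (by
        simp only [List.append_assoc, List.cons_append, link_append] at hA ⊢
        refine ⟨hA.1, ?_⟩
        have h2 := hA.2
        rw [← List.append_assoc, link_append] at h2
        exact h2.2)
      simp at this
      omega
  · intro w hw hwS
    obtain ⟨X, Z, rfl⟩ := List.append_of_mem hw
    have := hmin X w hwS (link_append.1 hA).1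
    simp at this

theorem Cyc.hasCycleThrough (hD : D.Loopless) {a : V} {l : List V} (h : D.Cyc a l) {S : Set V}
    (hS : ∀ s ∈ S, s ∈ a :: l) : D.HasCycleThrough S := by
  refine ⟨((a :: l : List V) : Cycle V), ⟨?_, h.2, ?_⟩, hS⟩
  · rw [Cycle.nontrivial_coe_nodup_iff h.2]
    rcases l with _ | ⟨b, l⟩
    · exact absurd h.1 (hD a)
    · simp
  · rw [Cycle.chain_coe_cons]
    have : ∀ (l : List V) (a b : V), D.Link a l b → List.IsChain D.Adj (a :: (l ++ [b])) := by
      intro l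
      induction l with
      | nil => intro a b h; simpa using h
      | cons x l ih => intro a b h; simpa using ⟨h.1, ih _ _ h.2⟩
    exact this _ _ _ h.1

theorem Cyc.split {a : V} {l : List V} (h : D.Cyc a l) {u v : V} (hu : u ∈ a :: l)
    (hv : v ∈ a :: l) (huv : u ≠ v) :
    ∃ M G, D.Link v M u ∧ D.Link u G v ∧ (v :: (M ++ u :: G)).Perm (a :: l) := by
  have h1 : ∃ l', D.Cyc v l' ∧ (v :: l').Perm (a :: l) := by
    rcases List.mem_cons.1 hv with rfl | hv
    · exact ⟨l, h, List.Perm.refl _⟩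
    · obtain ⟨X, Z, rfl⟩ := List.append_of_mem hv
      have hp : (v :: (Z ++ a :: X)).Perm (a :: (X ++ v :: Z)) := by
        refine (List.perm_append_comm (l₁ := v :: Z) (l₂ := a :: X)).trans ?_
        simp
      have := link_append.1 h.1
      exact ⟨Z ++ a :: X, ⟨link_append.2 ⟨this.2, this.1⟩, hp.nodup_iff.2 h.2⟩, hp⟩
  obtain ⟨l', hc, hp⟩ := h1
  have hu' := hp.mem_iff.2 hu
  rcases List.mem_cons.1 hu' with rfl | hu'
  · exact absurd rfl huv
  · obtain ⟨M, G, rfl⟩ := List.append_of_mem hu'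
    have := link_append.1 hc.1
    exact ⟨M, G, this.1, this.2, hp⟩

end Lists

/-! ### Bad pairs, and cycles through one or two vertices of `Y`. -/

section Basics

variable {V : Type*} {D : Digraph V}

theorem Loopless.arc_self (hD : D.Loopless) (x : V) : D.arc x x = 0 := arc_eq_zero.2 (hD x)

theorem Loopless.rev (hD : D.Loopless) : D.rev.Loopless := hD

theorem Loopless.ne (hD : D.Loopless) {x y : V} (h : D.Adj x y) : x ≠ y := by
  rintro rfl; exact hD _ h

theorem sum_map_le_one' {f : V → ℕ} {L : List V} (h1 : ∀ w, f w ≤ 1)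
    (h : ∀ X w Z, L = X ++ w :: Z → Z ≠ [] → f w = 0) : (L.map f).sum ≤ 1 := by
  have : (L.reverse.map f).sum ≤ 1 := by
    refine sum_map_le_one h1 fun X w Z hL hX => h Z.reverse w X.reverse ?_ (by simpa using hX)
    have := congrArg List.reverse hL
    simpa using this
  rwa [List.map_reverse, List.sum_reverse] at this

theorem le_yc {Y T : Finset V} {L : List V} (hT : T ⊆ Y) (h : ∀ t ∈ T, t ∈ L) :
    T.card ≤ yc Y L := by
  classical
  unfold yc
  exact Finset.card_le_card fun t ht => Finset.mem_filter.2 ⟨hT ht, h t ht⟩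

theorem yc_mono {Y : Finset V} {L L' : List V} (h : ∀ t ∈ Y, t ∈ L → t ∈ L') :
    yc Y L ≤ yc Y L' := by
  classical
  unfold yc
  refine Finset.card_le_card fun t ht => ?_
  rw [Finset.mem_filter] at ht ⊢
  exact ⟨ht.1, h t ht.1 ht.2⟩

theorem yc_lt {Y : Finset V} {L L' : List V} (h : ∀ t ∈ Y, t ∈ L → t ∈ L') {y : V} (hy : y ∈ Y)
    (hyL : y ∉ L) (hyL' : y ∈ L') : yc Y L < yc Y L' := by
  classical
  unfold yc
  refine Finset.card_lt_card ⟨fun t ht => ?_, fun hs => ?_⟩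
  · rw [Finset.mem_filter] at ht ⊢
    exact ⟨ht.1, h t ht.1 ht.2⟩
  · have := hs (Finset.mem_filter.2 ⟨hy, hyL'⟩)
    exact hyL (Finset.mem_filter.1 this).2

theorem yc_reverse {Y : Finset V} {L : List V} : yc Y L.reverse = yc Y L := by
  classical
  unfold yc
  congr 1
  ext x
  simp

/-- An exchange that loses at most `g` and gains two vertices of `Y`. -/
theorem yc_lt_of_two {Y : Finset V} {L L' : List V} {g y y' : V}
    (h : ∀ t ∈ Y, t ∈ L → t ≠ g → t ∈ L') (hy : y ∈ Y) (hyL : y ∉ L) (hyL' : y ∈ L')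
    (hy' : y' ∈ Y) (hyL2 : y' ∉ L) (hyL2' : y' ∈ L') (hne : y ≠ y') : yc Y L < yc Y L' := by
  classical
  have h1 : yc Y L ≤ ((Y.filter (· ∈ L)).erase g).card + 1 := by
    unfold yc
    have := Finset.pred_card_le_card_erase (a := g) (s := Y.filter (· ∈ L))
    omega
  have h2 : (insert y (insert y' ((Y.filter (· ∈ L)).erase g))).card =
      ((Y.filter (· ∈ L)).erase g).card + 2 := by
    rw [Finset.card_insert_of_notMem (by simp [hne, hyL]),
      Finset.card_insert_of_notMem (by simp [hyL2])]
  have h3 : (insert y (insert y' ((Y.filter (· ∈ L)).erase g))).card ≤ yc Y L' := by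
    refine le_yc (fun t ht => ?_) (fun t ht => ?_) <;>
      simp only [Finset.mem_insert, Finset.mem_erase, Finset.mem_filter] at ht <;>
      rcases ht with rfl | rfl | ht <;> first | assumption | skip
    · exact ht.2.1
    · exact h t ht.2.1 ht.2.2 ht.1
  omega

theorem outDeg_rev (x : V) : D.rev.outDeg x = D.inDeg x := rfl

theorem inDeg_rev (x : V) : D.rev.inDeg x = D.outDeg x := rfl

theorem deg_rev (x : V) : D.rev.deg x = D.deg x := Nat.add_comm _ _

theorem StronglyConnectedOn.rev {Y : Set V} (h : D.StronglyConnectedOn Y) :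
    D.rev.StronglyConnectedOn Y := fun x hx y hy hxy =>
  Relation.reflTransGen_swap.1 (h y hy x hx hxy.symm)

theorem exists_cyc_of_adj (hD : D.Loopless) {x y : V} (hxy : D.Adj x y)
    (h : Relation.ReflTransGen D.Adj y x) : ∃ a l, D.Cyc a l ∧ x ∈ a :: l ∧ y ∈ a :: l := by
  obtain ⟨A, v, rfl, hA, hn, hAS, -⟩ :=
    exists_shortest (S := {x}) (a := y) (fun e => hD.ne hxy e.symm) rfl h
  refine ⟨v, y :: A, ⟨⟨hxy, hA⟩, List.nodup_cons.2 ⟨?_, hn⟩⟩, by simp, by simp⟩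
  intro hm
  rcases List.mem_cons.1 hm with e | hm
  · exact hD.ne hxy e
  · exact hAS _ hm rfl

theorem exists_cyc_one {x y : V} (hD : D.Loopless) (hxy : x ≠ y)
    (h : Relation.ReflTransGen D.Adj x y) (h' : Relation.ReflTransGen D.Adj y x) :
    ∃ a l, D.Cyc a l ∧ x ∈ a :: l := by
  rcases Relation.ReflTransGen.cases_head h with rfl | ⟨w, hw, hwy⟩
  · exact absurd rfl hxy
  · obtain ⟨a, l, h1, h2, -⟩ := exists_cyc_of_adj hD hw (hwy.trans h')
    exact ⟨a, l, h1, h2⟩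

variable [Fintype V]

theorem ConditionA0.rev {Y : Set V} (h : D.ConditionA0 Y) : D.rev.ConditionA0 Y := by
  intro x hx y hy z hz hzx hzy hn
  have := h x hx y hy z hz hzx hzy ⟨hn.1, hn.2.2, hn.2.1⟩
  rw [deg_rev, deg_rev]
  exact ⟨this.2, this.1⟩

/-- A nonadjacent pair of vertices of `Y` of small degree sum. -/
structure Bad (D : Digraph V) (Y : Finset V) (x y : V) : Prop where
  left : x ∈ Y
  right : y ∈ Y
  ne : x ≠ y
  not_adj : ¬ D.Adj x y
  not_adj' : ¬ D.Adj y x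
  deg_le : D.deg x + D.deg y + 2 ≤ 2 * Fintype.card V

theorem Bad.symm {Y : Finset V} {x y : V} (h : D.Bad Y x y) : D.Bad Y y x :=
  ⟨h.right, h.left, h.ne.symm, h.not_adj', h.not_adj, by have := h.deg_le; omega⟩

theorem Bad.rev {Y : Finset V} {x y : V} (h : D.Bad Y x y) : D.rev.Bad Y x y :=
  ⟨h.left, h.right, h.ne, h.not_adj', h.not_adj, by rw [deg_rev, deg_rev]; exact h.deg_le⟩

/-- The bad pair uses at most `2n - 2` of the `3n - 2` demanded by `A₀`. -/
theorem Bad.le_out {Y : Finset V} {x y z : V} (h : D.Bad Y x y) (hA : D.ConditionA0 (Y : Set V))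
    (hz : z ∈ Y) (hzx : z ≠ x) (hzy : z ≠ y) (hxz : ¬ D.Adj x z) :
    Fintype.card V ≤ D.outDeg x + D.inDeg z := by
  have h1 := (hA x h.left y h.right z hz hzx hzy ⟨h.ne, h.not_adj, h.not_adj'⟩).1 hxz
  have := h.deg_le
  omega

theorem Bad.le_in {Y : Finset V} {x y z : V} (h : D.Bad Y x y) (hA : D.ConditionA0 (Y : Set V))
    (hz : z ∈ Y) (hzx : z ≠ x) (hzy : z ≠ y) (hxz : ¬ D.Adj z x) :
    Fintype.card V ≤ D.outDeg z + D.inDeg x := by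
  have := h.rev.le_out hA.rev hz hzx hzy hxz
  rwa [outDeg_rev, inDeg_rev, Nat.add_comm] at this

/-- Hence two different bad pairs never share a vertex; this is the source of several contradictions
below. -/
theorem Bad.le_deg {Y : Finset V} {x y z : V} (h : D.Bad Y x y) (hA : D.ConditionA0 (Y : Set V))
    (hz : z ∈ Y) (hzx : z ≠ x) (hzy : z ≠ y) (hxz : ¬ D.Adj x z) (hzx' : ¬ D.Adj z x) :
    2 * Fintype.card V ≤ D.deg x + D.deg z := by
  have h1 := h.le_out hA hz hzx hzy hxz
  have h2 := h.le_in hA hz hzx hzy hzx'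
  unfold deg
  omega

theorem out_add_in (x z : V) : D.outDeg x + D.inDeg z = ∑ w, (D.arc x w + D.arc w z) := by
  rw [outDeg_eq, inDeg_eq, Finset.sum_add_distrib]

theorem deg_add_deg (x z : V) : D.deg x + D.deg z =
    ∑ w, ((D.arc x w + D.arc w z) + (D.arc z w + D.arc w x)) := by
  rw [Finset.sum_add_distrib, ← out_add_in, ← out_add_in]
  unfold deg
  omega

/-- If `s` were the only possible midpoint, the sum would be at most `2 + (n - 3)`, since `x` and
`z` contribute nothing. -/
theorem exists_mid_ne (hD : D.Loopless) {x z : V} (hxz : x ≠ z) (hn : ¬ D.Adj x z)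
    (h : Fintype.card V ≤ D.outDeg x + D.inDeg z) (s : V) :
    ∃ r, r ≠ s ∧ D.Adj x r ∧ D.Adj r z := by
  classical
  by_contra hc
  push Not at hc
  rw [out_add_in] at h
  have hL : ([x, z] : List V).Nodup := by simpa using hxz
  have hx := hD.arc_self x
  have hz := hD.arc_self z
  have hxz0 := arc_eq_zero.2 hn
  by_cases hs : s ∈ [x, z]
  · have := sum_univ_le (f := fun w => D.arc x w + D.arc w z) hL (c := 1) (fun w hw =>
      arc_add_arc_le_one fun hw' => hc w (fun e => hw (e ▸ hs)) hw'.1 hw'.2)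
    simp [hx, hz, hxz0] at this
    omega
  · have := sum_univ_le (f := fun w => D.arc x w + D.arc w z) (L := s :: [x, z])
      (List.nodup_cons.2 ⟨hs, hL⟩) (c := 1) (fun w hw =>
      arc_add_arc_le_one fun hw' => hc w (fun e => hw (by simp [e])) hw'.1 hw'.2)
    have h1 := arc_le_one (D := D) x s
    have h2 := arc_le_one (D := D) s z
    simp [hx, hz, hxz0] at this
    omega

/-- Along a shortest path from `z` to `t`, at most one interior vertex receives an arc from `z` and
at most one sends an arc to `t`. If no `w` off the path gave `t → w → z`, the degree sum would be at
most `2n - 2`. -/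
theorem exists_cyc_of_oneway (hD : D.Loopless) {z t : V} (hzt : z ≠ t) (h1 : ¬ D.Adj z t)
    (h2 : ¬ D.Adj t z) (hdeg : 2 * Fintype.card V ≤ D.deg z + D.deg t + 1)
    (hr : Relation.ReflTransGen D.Adj z t) (hmid : ∀ r, D.Adj z r → ¬ D.Adj r t) :
    ∃ a l, D.Cyc a l ∧ z ∈ a :: l ∧ t ∈ a :: l := by
  obtain ⟨A, v, rfl, hA, hn, hAS, hmin⟩ := exists_shortest (S := {t}) (a := z) hzt rfl hr
  by_contra hc
  have hvA : v ∉ A := fun hm => hAS _ hm rfl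
  have hL : (z :: (A ++ [v])).Nodup := by
    simp only [List.nodup_cons, List.nodup_append, List.mem_append] at hn ⊢
    aesop
  have hoff : ∀ w, w ∉ z :: (A ++ [v]) → ¬ (D.Adj v w ∧ D.Adj w z) := by
    rintro w hw ⟨hw1, hw2⟩
    refine hc ⟨z, A ++ [v, w], ⟨by simp [hA, hw1, hw2], ?_⟩, by simp, by simp⟩
    have : (w :: z :: (A ++ [v])).Nodup := List.nodup_cons.2 ⟨hw, hL⟩
    refine (List.Perm.nodup_iff ?_).1 this
    have := List.perm_append_comm (l₁ := [w]) (l₂ := z :: (A ++ [v]))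
    simpa using this
  have hsum := sum_univ_le (f := fun w => (D.arc z w + D.arc w v) + (D.arc v w + D.arc w z)) hL
    (c := 2) (fun w hw => add_le_add (arc_add_arc_le_one fun h => hmid w h.1 h.2)
      (arc_add_arc_le_one (hoff w hw)))
  rw [← deg_add_deg] at hsum
  have s1 : (A.map (D.arc z ·)).sum ≤ 1 := by
    refine sum_map_le_one (fun w => arc_le_one _ _) fun X w Z hX hne => arc_eq_zero.2 fun hw => ?_
    subst hX
    have := hmin (w :: Z) v rfl ⟨hw, (link_append.1 hA).2⟩
    simp at this
    exact hne this
  have s2 : (A.map (D.arc · v)).sum ≤ 1 := by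
    refine sum_map_le_one' (fun w => arc_le_one _ _) fun X w Z hX hne => arc_eq_zero.2 fun hw => ?_
    subst hX
    have := hmin (X ++ [w]) v rfl (by simpa using ⟨(link_append.1 hA).1, hw⟩)
    simp at this
    exact hne this
  have s3 : (A.map (D.arc v ·)).sum ≤ 1 * A.length := sum_map_le fun w _ => arc_le_one _ _
  have s4 : (A.map (D.arc · z)).sum ≤ 1 * A.length := sum_map_le fun w _ => arc_le_one _ _
  simp [List.sum_map_add, hD.arc_self, arc_eq_zero.2 h1, arc_eq_zero.2 h2] at hsum
  linarith

theorem exists_cyc_of_deg (hD : D.Loopless) {z t : V} (hzt : z ≠ t) (h1 : ¬ D.Adj z t)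
    (h2 : ¬ D.Adj t z) (hdeg : 2 * Fintype.card V ≤ D.deg z + D.deg t + 1)
    (hr : Relation.ReflTransGen D.Adj z t) (hr' : Relation.ReflTransGen D.Adj t z) :
    ∃ a l, D.Cyc a l ∧ z ∈ a :: l ∧ t ∈ a :: l := by
  by_cases hp : ∀ r, D.Adj z r → ¬ D.Adj r t
  · exact exists_cyc_of_oneway hD hzt h1 h2 hdeg hr hp
  by_cases hq : ∀ r, D.Adj t r → ¬ D.Adj r z
  · obtain ⟨a, l, h⟩ := exists_cyc_of_oneway hD hzt.symm h2 h1 (by omega) hr' hq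
    exact ⟨a, l, h.1, h.2.2, h.2.1⟩
  push Not at hp hq
  obtain ⟨r, hr1, hr2⟩ := hp
  obtain ⟨s, hs1, hs2⟩ := hq
  have key : ∀ p q, D.Adj z p → D.Adj p t → D.Adj t q → D.Adj q z → p ≠ q →
      ∃ a l, D.Cyc a l ∧ z ∈ a :: l ∧ t ∈ a :: l := by
    intro p q a1 a2 a3 a4 hpq
    refine ⟨z, [p, t, q], ⟨by simp [*], ?_⟩, by simp, by simp⟩
    have := hD.ne a1; have := hD.ne a2; have := hD.ne a3; have := hD.ne a4
    simp [*, Ne.symm]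
  by_contra hc
  -- Different midpoints in the two directions would close a 4-cycle. So all midpoints coincide in
  -- one vertex, which contributes at most 4, and the degree sum is at most `4 + 2(n - 3)`.
  have hsr : r = s := by
    by_contra hne
    exact hc (key r s hr1 hr2 hs1 hs2 hne)
  subst hsr
  have hL : ([z, t, r] : List V).Nodup := by
    have := hD.ne hr1; have := hD.ne hs1
    simp [*]
  have hsum := sum_univ_le (f := fun w => (D.arc z w + D.arc w t) + (D.arc t w + D.arc w z)) hL
    (c := 2) (fun w hw => by
      have hwr : w ≠ r := fun e => hw (by simp [e])
      exact add_le_add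
        (arc_add_arc_le_one fun h => hc (key w r h.1 h.2 hs1 hs2 hwr))
        (arc_add_arc_le_one fun h => hc (key r w hr1 hr2 h.1 h.2 hwr.symm)))
  rw [← deg_add_deg] at hsum
  have := arc_le_one (D := D) z r
  have := arc_le_one (D := D) r z
  have := arc_le_one (D := D) t r
  have := arc_le_one (D := D) r t
  simp [hD.arc_self, arc_eq_zero.2 h1, arc_eq_zero.2 h2] at hsum
  omega

/-- An adjacent pair closes up by strong connectivity and a nonadjacent pair of large degree sum by
`exists_cyc_of_deg`. A bad pair `x, y` gives distinct midpoints in the two directions between `x`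
and a third vertex nonadjacent to it. -/
theorem exists_cyc_two {Y : Finset V} (hD : D.Loopless) (hA : D.ConditionA0 (Y : Set V))
    (hS : D.StronglyConnectedOn (Y : Set V)) (hY : 3 ≤ Y.card) :
    ∃ a l, D.Cyc a l ∧ 2 ≤ yc Y (a :: l) := by
  classical
  obtain ⟨x, y, z, hx, hy, hz, hxy, hxz, hyz⟩ := Finset.two_lt_card_iff.1 hY
  suffices h : ∃ x ∈ Y, ∃ y ∈ Y, x ≠ y ∧ ∃ a l, D.Cyc a l ∧ x ∈ a :: l ∧ y ∈ a :: l by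
    obtain ⟨x, hx, y, hy, hxy, a, l, hc, hxl, hyl⟩ := h
    refine ⟨a, l, hc, ?_⟩
    rw [← Finset.card_pair hxy]
    refine le_yc ?_ ?_
    · intro t ht; simp at ht; rcases ht with rfl | rfl <;> assumption
    · intro t ht; simp only [Finset.mem_insert, Finset.mem_singleton] at ht
      rcases ht with rfl | rfl <;> assumption
  have hadj : ∀ x ∈ Y, ∀ y ∈ Y, D.Adj x y →
      ∃ x ∈ Y, ∃ y ∈ Y, x ≠ y ∧ ∃ a l, D.Cyc a l ∧ x ∈ a :: l ∧ y ∈ a :: l :=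
    fun x hx y hy h => ⟨x, hx, y, hy, hD.ne h,
      exists_cyc_of_adj hD h (hS y hy x hx (hD.ne h).symm)⟩
  by_cases h1 : D.Adj x y
  · exact hadj x hx y hy h1
  by_cases h2 : D.Adj y x
  · exact hadj y hy x hx h2
  by_cases hdeg : 2 * Fintype.card V ≤ D.deg x + D.deg y + 1
  · exact ⟨x, hx, y, hy, hxy, exists_cyc_of_deg hD hxy h1 h2 hdeg (hS x hx y hy hxy)
      (hS y hy x hx hxy.symm)⟩
  have hb : D.Bad Y x y := ⟨hx, hy, hxy, h1, h2, by omega⟩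
  by_cases h3 : D.Adj x z
  · exact hadj x hx z hz h3
  by_cases h4 : D.Adj z x
  · exact hadj z hz x hx h4
  obtain ⟨r, -, hr1, hr2⟩ := exists_mid_ne hD hxz h3 (hb.le_out hA hz hxz.symm hyz.symm h3) x
  obtain ⟨s, hsr, hs1, hs2⟩ := exists_mid_ne hD hxz.symm h4 (hb.le_in hA hz hxz.symm hyz.symm h4) r
  refine ⟨x, hx, z, hz, hxz, x, [r, z, s], ⟨by simp [*], ?_⟩, by simp, by simp⟩
  have := hD.ne hr1; have := hD.ne hr2; have := hD.ne hs1; have := (hD.ne hs2).symm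
  simp [*, hsr.symm]

end Basics

/-! ### Minimal bypasses of a cycle and the bad pairs that they create. -/

section Bypass

variable {V : Type*} {D : Digraph V} {Y : Finset V} {K : ℕ}

/-- A cycle `v, M, u, G` together with a path `u, B, v` that meets it only in `u` and `v`. -/
structure Theta (D : Digraph V) (u v : V) (M G B : List V) : Prop where
  path : D.Link v M u
  gap : D.Link u G v
  ear : D.Link u B v
  nodup : (v :: (M ++ u :: (G ++ B))).Nodup

/-- A configuration `Theta` on a cycle with `K` vertices of `Y`, with a vertex of `Y` on the ear
`B`, in which the number of vertices of `Y` on `G` and then the length of `G` and `B` is minimal. -/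
structure OptTheta (D : Digraph V) (Y : Finset V) (K : ℕ) (u v : V) (M G B : List V) : Prop extends
    Theta D u v M G B where
  yc_eq : yc Y (v :: (M ++ u :: G)) = K
  ear_mem : ∃ y ∈ B, y ∈ Y
  min : ∀ u' v' M' G' B', Theta D u' v' M' G' B' → yc Y (v' :: (M' ++ u' :: G')) = K →
    (∃ y ∈ B', y ∈ Y) →
      yc Y G ≤ yc Y G' ∧ (yc Y G' = yc Y G → G.length + B.length ≤ G'.length + B'.length)

theorem yc_congr {Y : Finset V} {L L' : List V} (h : ∀ t, t ∈ L ↔ t ∈ L') :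
    yc Y L = yc Y L' :=
  le_antisymm (yc_mono fun t _ => (h t).1) (yc_mono fun t _ => (h t).2)

theorem Cyc.rev {a : V} {l : List V} (h : D.Cyc a l) : D.rev.Cyc a l.reverse :=
  ⟨link_rev.2 h.1, by simpa using h.2⟩

theorem Theta.rev {u v : V} {M G B : List V} (T : Theta D u v M G B) :
    Theta D.rev v u M.reverse G.reverse B.reverse where
  path := link_rev.2 T.path
  gap := link_rev.2 T.gap
  ear := link_rev.2 T.ear
  nodup := by
    classical
    have h := T.nodup
    rw [List.nodup_iff_count_le_one] at h ⊢
    intro x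
    have := h x
    simp only [List.count_append, List.count_cons, List.count_reverse] at this ⊢
    omega

theorem OptTheta.rev {u v : V} {M G B : List V} (T : OptTheta D Y K u v M G B) :
    OptTheta D.rev Y K v u M.reverse G.reverse B.reverse where
  toTheta := T.toTheta.rev
  yc_eq := by
    rw [← T.yc_eq]
    refine yc_congr fun t => ?_
    simp
    tauto
  ear_mem := by simpa using T.ear_mem
  min u' v' M' G' B' T' h1 h2 := by
    have := T.min _ _ _ _ _ T'.rev (by
      rw [← h1]
      refine yc_congr fun t => ?_
      simp
      tauto) (by simpa using h2)
    simpa [yc_reverse] using this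

theorem Theta.cyc_gap {u v : V} {M G B : List V} (T : Theta D u v M G B) :
    D.Cyc v (M ++ u :: G) :=
  ⟨link_append.2 ⟨T.path, T.gap⟩, T.nodup.sublist (by simp)⟩

variable {u v : V} {M G B : List V}

theorem OptTheta.not_mem (T : OptTheta D Y K u v M G B) {y : V} (hy : y ∈ B) :
    y ∉ v :: (M ++ u :: G) := by
  have := T.nodup
  intro h
  have h2 : ((v :: (M ++ u :: G)) ++ B).Nodup := by simpa using this
  exact (List.nodup_append.1 h2).2.2 y h y hy rfl

/-- Such an arc would turn the initial part of the ear into an ear from `u` to `h` of the same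
cycle, with a smaller gap. -/
theorem OptTheta.not_adj_gap (T : OptTheta D Y K u v M G B) {y h : V} (hyB : y ∈ B) (hy : y ∈ Y)
    (hh : h ∈ G) : ¬ D.Adj y h := by
  classical
  intro hyh
  obtain ⟨G₁, G₂, rfl⟩ := List.append_of_mem hh
  obtain ⟨B₁, B₂, rfl⟩ := List.append_of_mem hyB
  have hg := link_append.1 T.gap
  have hb := link_append.1 T.ear
  have := T.min u h (G₂ ++ v :: M) G₁ (B₁ ++ [y])
    ⟨link_append.2 ⟨hg.2, T.path⟩, hg.1, link_append.2 ⟨hb.1, hyh⟩, by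
      have h := T.nodup
      rw [List.nodup_iff_count_le_one] at h ⊢
      intro x
      have := h x
      simp only [List.count_append, List.count_cons, List.count_nil] at this ⊢
      omega⟩
    (by
      rw [← T.yc_eq]
      refine yc_congr fun t => ?_
      simp
      tauto) ⟨y, by simp, hy⟩
  have h1 : yc Y G₁ ≤ yc Y (G₁ ++ h :: G₂) := yc_mono fun t _ ht => by simp [ht]
  have h2 := this.2 (by omega)
  simp at h2
  omega

theorem OptTheta.not_adj_gap' (T : OptTheta D Y K u v M G B) {y h : V} (hyB : y ∈ B) (hy : y ∈ Y)
    (hh : h ∈ G) : ¬ D.Adj h y :=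
  T.rev.not_adj_gap (by simpa using hyB) hy (by simpa using hh)

/-- The detour through `r` may lengthen the ear, but `g` leaves the gap, and vertices of `Y` on the
gap are minimized first. -/
theorem OptTheta.not_mid (T : OptTheta D Y K u v M G B) {y g r : V} (hyB : y ∈ B) (hy : y ∈ Y)
    (hgG : g ∈ G) (hg : g ∈ Y) (hr : r ∉ v :: (M ++ u :: (G ++ B))) :
    ¬ (D.Adj y r ∧ D.Adj r g) := by
  classical
  rintro ⟨h1, h2⟩
  obtain ⟨G₁, G₂, rfl⟩ := List.append_of_mem hgG
  obtain ⟨B₁, B₂, rfl⟩ := List.append_of_mem hyB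
  have hga := link_append.1 T.gap
  have hb := link_append.1 T.ear
  have hn := List.nodup_cons.2 ⟨hr, T.nodup⟩
  rw [List.nodup_iff_count_le_one] at hn
  have := T.min u g (G₂ ++ v :: M) G₁ (B₁ ++ [y, r])
    ⟨link_append.2 ⟨hga.2, T.path⟩, hga.1, link_append.2 ⟨hb.1, h1, h2⟩, by
      rw [List.nodup_iff_count_le_one]
      intro x
      have := hn x
      simp only [List.count_append, List.count_cons, List.count_nil] at this ⊢
      omega⟩
    (by
      rw [← T.yc_eq]
      refine yc_congr fun t => ?_
      simp
      tauto) ⟨y, by simp, hy⟩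
  have h1 : yc Y G₁ < yc Y (G₁ ++ g :: G₂) := by
    refine yc_lt (fun t _ ht => by simp [ht]) hg (fun hm => ?_) (by simp)
    have := hn g
    have h' := List.count_pos_iff.2 hm
    simp only [List.count_append, List.count_cons_self, List.count_cons] at this
    omega
  omega

theorem OptTheta.not_mid' (T : OptTheta D Y K u v M G B) {y g r : V} (hyB : y ∈ B) (hy : y ∈ Y)
    (hgG : g ∈ G) (hg : g ∈ Y) (hr : r ∉ v :: (M ++ u :: (G ++ B))) :
    ¬ (D.Adj g r ∧ D.Adj r y) := fun h =>
  T.rev.not_mid (r := r) (by simpa using hyB) hy (g := g) (by simpa using hgG) hg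
    (by simp at hr ⊢; tauto) ⟨h.2, h.1⟩

/-- The rest of the ear from `w` on still contains `y` and would bypass only the part of the gap
after `g`. -/
theorem OptTheta.not_adj_left {B₁ B₂ : List V} {y g w : V}
    (T : OptTheta D Y K u v M G (B₁ ++ y :: B₂)) (hy : y ∈ Y) (hgG : g ∈ G) (hg : g ∈ Y)
    (hw : w ∈ B₁) : ¬ D.Adj g w := by
  classical
  intro hgw
  obtain ⟨G₁, G₂, rfl⟩ := List.append_of_mem hgG
  obtain ⟨B₁, B', rfl⟩ := List.append_of_mem hw
  have hga := link_append.1 T.gap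
  have hb := link_append.1 T.ear
  have hb1 := link_append.1 hb.1
  have hn := T.nodup
  rw [List.nodup_iff_count_le_one] at hn
  have := T.min g v (M ++ u :: G₁) G₂ (w :: (B' ++ y :: B₂))
    ⟨link_append.2 ⟨T.path, hga.1⟩, hga.2, ⟨hgw, link_append.2 ⟨hb1.2, hb.2⟩⟩, by
      rw [List.nodup_iff_count_le_one]
      intro x
      have := hn x
      simp only [List.count_append, List.count_cons] at this ⊢
      omega⟩
    (by
      rw [← T.yc_eq]
      refine yc_congr fun t => ?_
      simp) ⟨y, by simp, hy⟩
  have h1 : yc Y G₂ < yc Y (G₁ ++ g :: G₂) := by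
    refine yc_lt (fun t _ ht => by simp [ht]) hg (fun hm => ?_) (by simp)
    have := hn g
    have h' := List.count_pos_iff.2 hm
    simp only [List.count_append, List.count_cons_self, List.count_cons] at this
    omega
  omega

theorem OptTheta.not_adj_right {B₁ B₂ : List V} {y g w : V}
    (T : OptTheta D Y K u v M G (B₁ ++ y :: B₂)) (hy : y ∈ Y) (hgG : g ∈ G) (hg : g ∈ Y)
    (hw : w ∈ B₂) : ¬ D.Adj w g := by
  have T' := T.rev
  rw [List.reverse_append, List.reverse_cons, List.append_assoc, List.singleton_append] at T'
  exact T'.not_adj_left hy (by simpa using hgG) hg (by simpa using hw)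

/-- An arc into `y` from any vertex of the ear but its predecessor would shorten the ear. -/
theorem OptTheta.sum_left {B₁ B₂ : List V} {y : V}
    (T : OptTheta D Y K u v M G (B₁ ++ y :: B₂)) (hy : y ∈ Y) :
    ((u :: B₁).map (D.arc · y)).sum ≤ 1 := by
  classical
  have hb := link_append.1 T.ear
  have hn := T.nodup
  rw [List.nodup_iff_count_le_one] at hn
  refine sum_map_le_one' (fun w => arc_le_one _ _) fun X w Z hX hne => arc_eq_zero.2 fun hw => ?_
  rcases X with _ | ⟨x, X⟩
  · simp only [List.nil_append, List.cons.injEq] at hX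
    obtain ⟨rfl, rfl⟩ := hX
    have := T.min u v M G (y :: B₂) ⟨T.path, T.gap, ⟨hw, hb.2⟩, by
      rw [List.nodup_iff_count_le_one]
      intro x
      have := hn x
      simp only [List.count_append, List.count_cons] at this ⊢
      omega⟩ T.yc_eq ⟨y, by simp, hy⟩
    have := this.2 rfl
    simp at this
    exact hne this
  · simp only [List.cons_append, List.cons.injEq] at hX
    obtain ⟨rfl, rfl⟩ := hX
    have hb1 := link_append.1 hb.1
    have := T.min u v M G (X ++ w :: y :: B₂)
      ⟨T.path, T.gap, link_append.2 ⟨hb1.1, hw, hb.2⟩, by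
        rw [List.nodup_iff_count_le_one]
        intro x
        have := hn x
        simp only [List.count_append, List.count_cons] at this ⊢
        omega⟩ T.yc_eq ⟨y, by simp, hy⟩
    have := this.2 rfl
    simp at this
    exact hne this

theorem OptTheta.sum_right {B₁ B₂ : List V} {y : V}
    (T : OptTheta D Y K u v M G (B₁ ++ y :: B₂)) (hy : y ∈ Y) :
    ((v :: B₂).map (D.arc y ·)).sum ≤ 1 := by
  have T' := T.rev
  rw [List.reverse_append, List.reverse_cons, List.append_assoc, List.singleton_append] at T'
  have := T'.sum_left hy
  simpa [List.sum_reverse, List.map_reverse] using this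

variable [Fintype V]

/-- The standing assumptions: `D` satisfies the hypotheses of the theorem on `Y`, and every
directed cycle contains at most `K` vertices of `Y`. -/
structure Setting (D : Digraph V) (Y : Finset V) (K : ℕ) : Prop where
  loopless : D.Loopless
  a0 : D.ConditionA0 (Y : Set V)
  strong : D.StronglyConnectedOn (Y : Set V)
  max : ∀ a l, D.Cyc a l → yc Y (a :: l) ≤ K

theorem Setting.rev (S : Setting D Y K) : Setting D.rev Y K where
  loopless := S.loopless
  a0 := S.a0.rev
  strong := S.strong.rev
  max a l h := by
    have := S.max _ _ (Cyc.rev h)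
    rwa [yc_congr (L' := a :: l) (by simp)] at this

/-- On a cycle with the maximum number of vertices of `Y`, nothing can be inserted. -/
theorem Setting.no_ins (S : Setting D Y K) {a s t : V} {l Z : List V} (hc : D.Cyc a l)
    (hK : K ≤ yc Y (a :: l)) (hZ : ∀ x y, D.Adj x s → D.Adj t y → D.Link x Z y) (hn : Z.Nodup)
    (hd : ∀ z ∈ Z, z ∉ a :: l) {y : V} (hyZ : y ∈ Z) (hy : y ∈ Y) : ¬ D.Ins s t a l a := by
  classical
  intro hi
  obtain ⟨L₁, L₂, rfl, hL⟩ := hi.insert hc.1 hZ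
  have hcyc : D.Cyc a (L₁ ++ (Z ++ L₂)) := by
    refine ⟨hL, ?_⟩
    have h1 : (Z ++ (a :: (L₁ ++ L₂))).Nodup :=
      List.nodup_append.2 ⟨hn, hc.2, fun z hz w hw e => hd z hz (e ▸ hw)⟩
    rw [List.nodup_iff_count_le_one] at h1 ⊢
    intro x
    have := h1 x
    simp only [List.count_append, List.count_cons] at this ⊢
    omega
  have h1 := S.max _ _ hcyc
  have h2 : yc Y (a :: (L₁ ++ L₂)) < yc Y (a :: (L₁ ++ (Z ++ L₂))) := by
    refine yc_lt (fun t _ ht => ?_) hy (hd y hyZ) (by simp [hyZ])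
    simp at ht ⊢
    tauto
  omega

theorem Setting.no_ins_self (S : Setting D Y K) {a y : V} {l : List V} (hc : D.Cyc a l)
    (hK : K ≤ yc Y (a :: l)) (hy : y ∈ Y) (hyl : y ∉ a :: l) : ¬ D.Ins y y a l a :=
  S.no_ins (Z := [y]) hc hK (fun _ _ h h' => ⟨h, h'⟩) (by simp) (by simpa using hyl)
    (by simp) hy

/-- Minimality of the gap and ear, together with the failure to insert `y` and `g` into the path `v,
M, u`, bounds the arcs on the configuration by twice its order minus 2. Every other vertex
contributes at most 2. -/
theorem OptTheta.bad (S : Setting D Y K) (T : OptTheta D Y K u v M G B) {y g : V} (hyB : y ∈ B)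
    (hy : y ∈ Y) (hgG : g ∈ G) (hg : g ∈ Y) (hgi : ¬ D.Ins g g v M u) : D.Bad Y y g := by
  have hyg := T.not_adj_gap hyB hy hgG
  have hgy := T.not_adj_gap' hyB hy hgG
  refine ⟨hy, hg, ?_, hyg, hgy, ?_⟩
  · rintro rfl
    exact T.not_mem hyB (by simp [hgG])
  have hyi : ¬ D.Ins y y v M u := fun h =>
    S.no_ins_self T.cyc_gap T.yc_eq.ge hy (T.not_mem hyB) h.prefix
  have hy0 := fun h hh => arc_eq_zero.2 (T.not_adj_gap (h := h) hyB hy hh)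
  have hy0' := fun h hh => arc_eq_zero.2 (T.not_adj_gap' (h := h) hyB hy hh)
  have hmid := fun r hr => arc_add_arc_le_one (T.not_mid (r := r) hyB hy hgG hg hr)
  have hmid' := fun r hr => arc_add_arc_le_one (T.not_mid' (r := r) hyB hy hgG hg hr)
  obtain ⟨B₁, B₂, rfl⟩ := List.append_of_mem hyB
  have e1 := ins_count v M u hyi
  have e2 := ins_count v M u hgi
  have e3 := T.sum_left hy
  have e4 := T.sum_right hy
  have hB1 : (B₁.map (D.arc g ·)).sum ≤ 0 * B₁.length :=
    sum_map_le fun w hw => (arc_eq_zero.2 (T.not_adj_left hy hgG hg hw)).le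
  have hB2 : (B₂.map (D.arc · g)).sum ≤ 0 * B₂.length :=
    sum_map_le fun w hw => (arc_eq_zero.2 (T.not_adj_right hy hgG hg hw)).le
  have b1 : (B₁.map (D.arc · g)).sum ≤ 1 * B₁.length := sum_map_le fun w _ => arc_le_one _ _
  have b2 : (B₁.map (D.arc y ·)).sum ≤ 1 * B₁.length := sum_map_le fun w _ => arc_le_one _ _
  have b3 : (B₂.map (D.arc g ·)).sum ≤ 1 * B₂.length := sum_map_le fun w _ => arc_le_one _ _
  have b4 : (B₂.map (D.arc · y)).sum ≤ 1 * B₂.length := sum_map_le fun w _ => arc_le_one _ _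
  have g0 : (G.map (D.arc y ·)).sum ≤ 0 * G.length := sum_map_le fun w hw => (hy0 w hw).le
  have g0' : (G.map (D.arc · y)).sum ≤ 0 * G.length := sum_map_le fun w hw => (hy0' w hw).le
  have g1 : (G.map (D.arc g ·)).sum + 1 ≤ G.length ∧ (G.map (D.arc · g)).sum + 1 ≤ G.length := by
    obtain ⟨G₁, G₂, rfl⟩ := List.append_of_mem hgG
    have c1 : (G₁.map (D.arc g ·)).sum ≤ 1 * G₁.length := sum_map_le fun w _ => arc_le_one _ _
    have c2 : (G₁.map (D.arc · g)).sum ≤ 1 * G₁.length := sum_map_le fun w _ => arc_le_one _ _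
    have c3 : (G₂.map (D.arc g ·)).sum ≤ 1 * G₂.length := sum_map_le fun w _ => arc_le_one _ _
    have c4 : (G₂.map (D.arc · g)).sum ≤ 1 * G₂.length := sum_map_le fun w _ => arc_le_one _ _
    constructor <;>
    · simp only [List.map_append, List.map_cons, List.sum_append, List.sum_cons, List.length_append,
        List.length_cons, S.loopless.arc_self]
      linarith
  have hsum := sum_univ_le (f := fun w => (D.arc y w + D.arc w g) + (D.arc g w + D.arc w y))
    T.nodup (c := 2) (fun w hw => add_le_add (hmid w hw) (hmid' w hw))
  rw [← deg_add_deg] at hsum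
  have d1 := arc_le_one (D := D) u g
  have d2 := arc_le_one (D := D) g v
  have d3 := arc_eq_zero.2 hyg
  have d4 := arc_eq_zero.2 hgy
  have d5 := S.loopless.arc_self y
  simp only [List.map_append, List.map_cons, List.sum_append, List.sum_cons, List.length_append,
    List.length_cons, List.sum_map_add, List.map_nil, List.sum_nil, d3, d4, d5] at hsum e1 e2 e3 e4
  linarith [g1.1, g1.2]

end Bypass

/-! ### The unique non-insertable vertex of the gap, and exchanging gap and ear. -/

section Pivot

variable {V : Type*} {D : Digraph V} {Y : Finset V} {K : ℕ} {u v : V} {M G B : List V}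

theorem yc_le_of_one {L L' : List V} {g y : V}
    (h : ∀ t ∈ Y, t ∈ L → t ≠ g → t ∈ L') (hy : y ∈ Y) (hyL : y ∉ L) (hyL' : y ∈ L') :
    yc Y L ≤ yc Y L' := by
  classical
  have h1 : yc Y L ≤ ((Y.filter (· ∈ L)).erase g).card + 1 := by
    unfold yc
    have := Finset.pred_card_le_card_erase (a := g) (s := Y.filter (· ∈ L))
    omega
  have h2 : (insert y ((Y.filter (· ∈ L)).erase g)).card =
      ((Y.filter (· ∈ L)).erase g).card + 1 := by
    rw [Finset.card_insert_of_notMem (by simp [hyL])]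
  have h3 : (insert y ((Y.filter (· ∈ L)).erase g)).card ≤ yc Y L' := by
    refine le_yc (fun t ht => ?_) (fun t ht => ?_) <;>
      simp only [Finset.mem_insert, Finset.mem_erase, Finset.mem_filter] at ht <;>
      rcases ht with rfl | ht <;> first | assumption | skip
    · exact ht.2.1
    · exact h t ht.2.1 ht.2.2 ht.1
  omega

theorem exists_two_off {L : List V} (h : yc Y L + 2 ≤ Y.card) :
    ∃ y ∈ Y, ∃ y' ∈ Y, y ≠ y' ∧ y ∉ L ∧ y' ∉ L := by
  classical
  have h1 := Finset.card_filter_add_card_filter_not (s := Y) (fun x => x ∈ L)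
  have h2 : 1 < (Y.filter (fun x => x ∉ L)).card := by
    have : yc Y L = (Y.filter (fun x => x ∈ L)).card := by unfold yc; congr
    omega
  obtain ⟨y, hy, y', hy', hne⟩ := Finset.one_lt_card.1 h2
  rw [Finset.mem_filter] at hy hy'
  exact ⟨y, hy.1, y', hy'.1, hne, hy.2, hy'.2⟩

theorem cyc_replace {M' G₁ N : List V} (h1 : D.Link v M' u) (h2 : (v :: (M' ++ [u])).Nodup)
    (h3 : ∀ x ∈ M', x ∈ M ∨ x ∈ G₁) (h4 : D.Link u N v)
    (h5 : (v :: (M ++ u :: (G₁ ++ N))).Nodup) : D.Cyc v (M' ++ u :: N) := by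
  refine ⟨link_append.2 ⟨h1, h4⟩, ?_⟩
  have h6 : ((v :: (M ++ u :: G₁)) ++ N).Nodup := by simpa using h5
  obtain ⟨-, h7, h8⟩ := List.nodup_append.1 h6
  have h9 : ((v :: (M' ++ [u])) ++ N).Nodup := by
    refine List.nodup_append.2 ⟨h2, h7, fun a ha b hb => h8 a ?_ b hb⟩
    have := h3 a
    simp at ha ⊢
    tauto
  simpa using h9

/-- `g` is the only vertex of `Y` on `G` that cannot be inserted into the path `v, M, u`. -/
structure Pivot (D : Digraph V) (Y : Finset V) (u v : V) (M G : List V) (g : V) : Prop where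
  mem : g ∈ G
  memY : g ∈ Y
  not_ins : ¬ D.Ins g g v M u
  ins : ∀ h ∈ G, h ∈ Y → h ≠ g → D.Ins h h v M u

theorem Pivot.rev {g : V} (P : Pivot D Y u v M G g) :
    Pivot D.rev Y v u M.reverse G.reverse g where
  mem := by simpa using P.mem
  memY := P.memY
  not_ins h := P.not_ins (by simpa using ins_rev h)
  ins h hh hY hne := ins_rev (P.ins h (by simpa using hh) hY hne)

variable [Fintype V]

/-- Were all vertices of `Y` on `G` insertable, they could move into `M` while `B` replaces `G`,
giving a better cycle. Two non-insertable ones would give two bad pairs sharing `y`. -/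
theorem OptTheta.exists_pivot (S : Setting D Y K) (T : OptTheta D Y K u v M G B) :
    ∃ g, Pivot D Y u v M G g := by
  obtain ⟨y, hyB, hy⟩ := T.ear_mem
  have hex : ∃ g ∈ G, g ∈ Y ∧ ¬ D.Ins g g v M u := by
    by_contra hc
    push Not at hc
    obtain ⟨M', h1, h2, h3, h4, h5⟩ := multi_insert (Y : Set V) u v G.length G M u v le_rfl
      T.gap T.path T.cyc_gap.2 hc
    have := S.max _ _ (cyc_replace h1 h2 h4 T.ear T.nodup)
    have h6 : K < yc Y (v :: (M' ++ u :: B)) := by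
      rw [← T.yc_eq]
      refine yc_lt (fun t ht htC => ?_) hy (T.not_mem hyB) (by simp [hyB])
      have := h5 t
      have := h3 t
      simp at htC ⊢
      tauto
    omega
  obtain ⟨g, hgG, hg, hgi⟩ := hex
  refine ⟨g, hgG, hg, hgi, fun h hh hY hne => ?_⟩
  by_contra hhi
  have b1 := T.bad S hyB hy hgG hg hgi
  have b2 := T.bad S hyB hy hh hY hhi
  have := b1.le_deg S.a0 hY b2.ne.symm hne b2.not_adj b2.not_adj'
  have := b2.deg_le
  omega

/-- Traversing `B` instead of `G` loses only `g` from `Y`. By maximality `B` can bring no more than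
one vertex of `Y`, and `g` cannot be kept. -/
theorem OptTheta.exists_full (S : Setting D Y K) (T : OptTheta D Y K u v M G B) {g : V}
    (P : Pivot D Y u v M G g) :
    (∀ y ∈ B, y ∈ Y → ∀ y' ∈ B, y' ∈ Y → y = y') ∧
    ∃ M', (∀ x ∈ M, x ∈ M') ∧ (∀ x ∈ M', x ∈ M ∨ x ∈ G) ∧ g ∉ M' ∧ D.Cyc v (M' ++ u :: B) ∧
      K ≤ yc Y (v :: (M' ++ u :: B)) := by
  obtain ⟨y, hyB, hy⟩ := T.ear_mem
  obtain ⟨M', h1, h2, h3, h4, h5⟩ := multi_insert {x | x ∈ Y ∧ x ≠ g} u v G.length G M u v le_rfl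
    T.gap T.path T.cyc_gap.2 (fun s hs hsS => P.ins s hs hsS.1 hsS.2)
  have hcyc := cyc_replace h1 h2 h4 T.ear T.nodup
  have hmax := S.max _ _ hcyc
  have hsub : ∀ t ∈ Y, t ∈ v :: (M ++ u :: G) → t ≠ g → t ∈ v :: (M' ++ u :: B) := by
    intro t ht htC htg
    have := h5 t
    have := h3 t
    simp at htC this ⊢
    tauto
  refine ⟨fun y hyB hy y' hyB' hy' => ?_, M', h3, h4, fun hgM => ?_, hcyc, ?_⟩
  · by_contra hne
    have := yc_lt_of_two hsub hy (T.not_mem hyB) (by simp [hyB]) hy' (T.not_mem hyB')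
      (by simp [hyB']) hne
    rw [T.yc_eq] at this
    omega
  · have : yc Y (v :: (M ++ u :: G)) < yc Y (v :: (M' ++ u :: B)) := by
      refine yc_lt (fun t ht htC => ?_) hy (T.not_mem hyB) (by simp [hyB])
      by_cases htg : t = g
      · subst htg; simp [hgM]
      · exact hsub t ht htC htg
    rw [T.yc_eq] at this
    omega
  · rw [← T.yc_eq]
    exact yc_le_of_one hsub hy (T.not_mem hyB) (by simp [hyB])

/-- The same exchange with an ear that rejoins the cycle inside the gap: `X` replaces `G₁`, whose
insertable vertices of `Y` move into `M`. If the ear ends at `g`, nothing of `Y` is lost, so nothing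
can be gained. -/
theorem Pivot.ear (S : Setting D Y K) {X G₁ G₂ : List V} {g h : V}
    (P : Pivot D Y u v M (G₁ ++ h :: G₂) g) (hM : D.Link v M u)
    (hG : D.Link u (G₁ ++ h :: G₂) v) (hK : yc Y (v :: (M ++ u :: (G₁ ++ h :: G₂))) = K)
    (hX : D.Link u X h) (hn : (v :: (M ++ u :: ((G₁ ++ h :: G₂) ++ X))).Nodup) :
    (∀ y ∈ X, y ∈ Y → ∀ y' ∈ X, y' ∈ Y → y = y') ∧ (h = g → ∀ y ∈ X, y ∉ Y) := by
  classical
  have hg := link_append.1 hG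
  have hn' := hn
  rw [List.nodup_iff_count_le_one] at hn'
  obtain ⟨M', h1, h2, h3, h4, h5⟩ := multi_insert {x | x ∈ Y ∧ x ≠ g} u v G₁.length G₁ M u h le_rfl
    hg.1 hM (by
      rw [List.nodup_iff_count_le_one]
      intro x
      have := hn' x
      simp only [List.count_append, List.count_cons] at this ⊢
      omega) (fun s hs hsS => P.ins s (by simp [hs]) hsS.1 hsS.2)
  have hcyc := cyc_replace (N := X ++ h :: G₂) h1 h2 h4 (link_append.2 ⟨hX, hg.2⟩) (by
      rw [List.nodup_iff_count_le_one]
      intro x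
      have := hn' x
      simp only [List.count_append, List.count_cons] at this ⊢
      omega)
  have hmax := S.max _ _ hcyc
  have hsub : ∀ t ∈ Y, t ∈ v :: (M ++ u :: (G₁ ++ h :: G₂)) → t ≠ g →
      t ∈ v :: (M' ++ u :: (X ++ h :: G₂)) := by
    intro t ht htC htg
    have := h5 t
    have := h3 t
    simp at htC this ⊢
    tauto
  have hoff : ∀ y ∈ X, y ∉ v :: (M ++ u :: (G₁ ++ h :: G₂)) := by
    intro y hy hyC
    have hn2 : ((v :: (M ++ u :: (G₁ ++ h :: G₂))) ++ X).Nodup := by simpa using hn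
    exact (List.nodup_append.1 hn2).2.2 y hyC y hy rfl
  refine ⟨fun y hyX hy y' hyX' hy' => ?_, fun hhg y hyX hy => ?_⟩
  · by_contra hne
    have := yc_lt_of_two hsub hy (hoff y hyX) (by simp [hyX]) hy' (hoff y' hyX')
      (by simp [hyX']) hne
    omega
  · have : yc Y (v :: (M ++ u :: (G₁ ++ h :: G₂))) < yc Y (v :: (M' ++ u :: (X ++ h :: G₂))) := by
      refine yc_lt (fun t ht htC => ?_) hy (hoff y hyX) (by simp [hyX])
      by_cases htg : t = g
      · subst htg; simp [hhg]
      · exact hsub t ht htC htg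
    omega

/-- A link from `y` to `y'` would exclude arcs and two-step walks from `y'` to `g` by `Pivot.ear`.
Degree counts on the exchanged cycle, which misses both `g` and `y'`, then exclude the other
direction as well and contradict `Bad.le_deg`. -/
theorem OptTheta.not_jump (S : Setting D Y K) (T : OptTheta D Y K u v M G B) {g : V}
    (P : Pivot D Y u v M G g) {y y' : V} {J : List V} (hyB : y ∈ B) (hy : y ∈ Y) (hy' : y' ∈ Y)
    (hn : (J ++ y' :: v :: (M ++ u :: (G ++ B))).Nodup) : ¬ D.Link y J y' := by
  classical
  intro hJ
  have hb := T.bad S hyB hy P.mem P.memY P.not_ins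
  obtain ⟨B₁, B₂, rfl⟩ := List.append_of_mem hyB
  have hear := link_append.1 T.ear
  have hne : y ≠ y' := by
    rintro rfl
    rw [List.nodup_iff_count_le_one] at hn
    have := hn y
    simp only [List.count_append, List.count_cons, beq_self_eq_true, if_true] at this
    omega
  have hcn := hn
  rw [List.nodup_iff_count_le_one] at hcn
  have hyG : ∀ h ∈ G, ¬ D.Adj y' h := by
    intro h hh hadj
    obtain ⟨G₁, G₂, rfl⟩ := List.append_of_mem hh
    refine hne ((P.ear S (X := B₁ ++ y :: (J ++ [y'])) T.path T.gap T.yc_eq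
      (link_append.2 ⟨hear.1, link_append.2 ⟨hJ, hadj⟩⟩) ?_).1 y (by simp) hy y' (by simp) hy')
    rw [List.nodup_iff_count_le_one]
    intro x
    have := hcn x
    simp only [List.count_append, List.count_cons, List.count_nil] at this ⊢
    omega
  obtain ⟨-, M', h3, h4, hgM, hcyc, hK⟩ := T.exists_full S P
  have hgC : g ∉ v :: (M' ++ u :: (B₁ ++ y :: B₂)) := by
    intro hm
    have := hcn g
    have hg := List.count_pos_iff.2 P.mem
    have hg' : ∀ a, a = g → List.count g [a] = 1 := by rintro a rfl; simp
    simp only [List.count_append, List.count_cons, List.count_nil] at this hg'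
    have hB1 := List.count_pos_iff (a := g) (l := B₁)
    have hB2 := List.count_pos_iff (a := g) (l := B₂)
    simp only [List.mem_cons, List.mem_append] at hm
    rcases hm with h | h | h | h | h | h
    · have := hg' v h.symm; omega
    · exact hgM h
    · have := hg' u h.symm; omega
    · have := hB1.2 h; omega
    · have := hg' y h.symm; omega
    · have := hB2.2 h; omega
  have hyC0 : y' ∉ v :: (M ++ u :: (G ++ (B₁ ++ y :: B₂))) := by
    have := (List.nodup_append.1 hn).2.1
    exact (List.nodup_cons.1 this).1
  have hyC : y' ∉ v :: (M' ++ u :: (B₁ ++ y :: B₂)) := by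
    intro hm
    have := h4 y'
    simp at hm hyC0
    tauto
  have hgy : g ≠ y' := by
    rintro rfl
    exact hyC0 (by simp [P.mem])
  have hgg := S.loopless.arc_self g
  have hyy := S.loopless.arc_self y'
  have hyg := hyG g P.mem
  have hyg0 := arc_eq_zero.2 hyg
  have hL : (g :: y' :: v :: (M' ++ u :: (B₁ ++ y :: B₂))).Nodup := by
    rw [List.nodup_cons, List.nodup_cons]
    exact ⟨by rw [List.mem_cons]; tauto, hyC, hcyc.2⟩
  have hmid : ∀ w, w ∉ g :: y' :: v :: (M' ++ u :: (B₁ ++ y :: B₂)) →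
      ¬ (D.Adj y' w ∧ D.Adj w g) := by
    rintro w hw ⟨hw1, hw2⟩
    have hwG : w ∉ G := fun hm => hyG w hm hw1
    obtain ⟨G₁, G₂, hGe⟩ := List.append_of_mem P.mem
    subst hGe
    by_cases hwJ : w ∈ J
    · obtain ⟨J₁, J₂, rfl⟩ := List.append_of_mem hwJ
      refine (P.ear S (X := B₁ ++ y :: (J₁ ++ [w])) T.path T.gap T.yc_eq
        (link_append.2 ⟨hear.1, link_append.2 ⟨(link_append.1 hJ).1, hw2⟩⟩) ?_).2 rfl y (by simp) hy
      rw [List.nodup_iff_count_le_one]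
      intro x
      have := hcn x
      simp only [List.count_append, List.count_cons, List.count_nil] at this ⊢
      omega
    · have hwn : (w :: (J ++ y' :: v :: (M ++ u :: ((G₁ ++ g :: G₂) ++ (B₁ ++ y :: B₂))))).Nodup := by
        refine List.nodup_cons.2 ⟨fun hm => ?_, hn⟩
        have := h3 w
        simp at hm hw hwG
        tauto
      refine (P.ear S (X := B₁ ++ y :: (J ++ [y', w])) T.path T.gap T.yc_eq
        (link_append.2 ⟨hear.1, link_append.2 ⟨hJ, hw1, hw2⟩⟩) ?_).2 rfl y (by simp) hy
      rw [List.nodup_iff_count_le_one] at hwn ⊢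
      intro x
      have := hwn x
      simp only [List.count_append, List.count_cons, List.count_nil] at this ⊢
      omega
  -- Otherwise `d⁺(y') + d⁻(g)` is at most `n - 2`, whereas the bad pair `g, y` forces at least `n`.
  have hins : D.Ins g y' v (M' ++ u :: (B₁ ++ y :: B₂)) v := by
    by_contra hi
    have h1 := ins_count_closed _ _ hi
    have h2 := hb.symm.le_in S.a0 hy' hgy.symm hne.symm hyg
    have h3 := sum_univ_le (f := fun w => D.arc y' w + D.arc w g) hL (c := 1)
      (fun w hw => arc_add_arc_le_one (hmid w hw))
    rw [← out_add_in] at h3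
    generalize v :: (M' ++ u :: (B₁ ++ y :: B₂)) = C at *
    simp only [List.map_cons, List.sum_cons, List.length_cons, List.sum_map_add, hgg, hyy,
      hyg0] at h3
    linarith
  -- A path from `g` to `y'` off the exchanged cycle could be inserted as a whole at the place just
  -- found.
  have hno : ∀ r : List V, (∀ x ∈ r, x ∉ g :: y' :: v :: (M' ++ u :: (B₁ ++ y :: B₂))) → r.Nodup →
      ¬ D.Link g r y' := by
    intro r hr hrn hlink
    have hZn : (g :: (r ++ [y'])).Nodup := by
      simp only [List.nodup_cons, List.nodup_append, List.mem_append, List.mem_cons,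
        List.not_mem_nil, List.nodup_nil] at hr ⊢
      grind
    refine S.no_ins (Z := g :: (r ++ [y'])) hcyc hK (fun a b ha hb => ⟨ha, link_append.2 ⟨hlink, hb⟩⟩)
      hZn ?_ (by simp : y' ∈ _) hy' hins
    intro z hz hzC
    rcases List.mem_cons.1 hz with rfl | hz
    · exact hgC hzC
    rcases List.mem_append.1 hz with hz | hz
    · exact hr z hz (by simp only [List.mem_cons] at hzC ⊢; tauto)
    · rw [List.mem_singleton] at hz
      subst hz
      exact hyC hzC
  have hgy' : ¬ D.Adj g y' := hno [] (by simp) (by simp)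
  have hmid' : ∀ w, w ∉ g :: y' :: v :: (M' ++ u :: (B₁ ++ y :: B₂)) →
      ¬ (D.Adj g w ∧ D.Adj w y') := fun w hw h => hno [w] (by simpa using hw) (by simp) h
  have h1 := ins_count_closed _ _ (S.no_ins_self hcyc hK hy' hyC)
  have h2 := ins_count_closed _ _ (S.no_ins_self hcyc hK P.memY hgC)
  have h3 := hb.symm.le_deg S.a0 hy' hgy.symm hne.symm hgy' hyg
  have h4 := sum_univ_le (f := fun w => (D.arc g w + D.arc w y') + (D.arc y' w + D.arc w g)) hL
    (c := 2) (fun w hw => add_le_add (arc_add_arc_le_one (hmid' w hw))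
      (arc_add_arc_le_one (hmid w hw)))
  rw [← deg_add_deg] at h4
  have hgy0 := arc_eq_zero.2 hgy'
  generalize v :: (M' ++ u :: (B₁ ++ y :: B₂)) = C at *
  simp only [List.map_cons, List.sum_cons, List.length_cons, List.sum_map_add, hgg, hyy,
    hyg0, hgy0] at h4
  linarith

theorem OptTheta.not_jump' (S : Setting D Y K) (T : OptTheta D Y K u v M G B) {g : V}
    (P : Pivot D Y u v M G g) {y y' : V} {J : List V} (hyB : y ∈ B) (hy : y ∈ Y) (hy' : y' ∈ Y)
    (hn : (J ++ y' :: v :: (M ++ u :: (G ++ B))).Nodup) : ¬ D.Link y' J y := by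
  classical
  intro hJ
  refine T.rev.not_jump S.rev P.rev (J := J.reverse) (by simpa using hyB) hy hy' ?_ (link_rev.2 hJ)
  rw [List.nodup_iff_count_le_one] at hn ⊢
  intro x
  have := hn x
  simp only [List.count_append, List.count_cons, List.count_reverse] at this ⊢
  omega

end Pivot

/-! ### Elimination of bypasses containing a vertex of `Y`. -/

section BypassEnd

variable {V : Type*} [Fintype V] {D : Digraph V} {Y : Finset V} {K : ℕ} {u v : V} {M G B : List V}

/-- Without arcs from `B₁` to `y'`, and with at most one arc from `y` to `v` and `B₂`, the sum
`d⁺(y) + d⁻(y')` would be at most `n - 1`. -/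
theorem OptTheta.exists_left {B₁ B₂ : List V} {y y' : V} (hD : D.Loopless)
    (T : OptTheta D Y K u v M G (B₁ ++ y :: B₂))
    (hy : y ∈ Y) (hn : (y' :: v :: (M ++ u :: (G ++ (B₁ ++ y :: B₂)))).Nodup)
    (hC : ((v :: (M ++ u :: G)).map fun w => D.arc y w + D.arc w y').sum ≤
      (v :: (M ++ u :: G)).length)
    (hmid : ∀ w, w ∉ y' :: v :: (M ++ u :: (G ++ (B₁ ++ y :: B₂))) → ¬ (D.Adj y w ∧ D.Adj w y'))
    (hdeg : Fintype.card V ≤ D.outDeg y + D.inDeg y') (hyy : ¬ D.Adj y y') :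
    ∃ r ∈ B₁, D.Adj r y' := by
  by_contra hc
  push Not at hc
  have h1 := T.sum_right hy
  have h2 := sum_univ_le (f := fun w => D.arc y w + D.arc w y') hn (c := 1)
    (fun w hw => arc_add_arc_le_one (hmid w hw))
  rw [← out_add_in] at h2
  have b1 : (B₁.map (D.arc · y')).sum ≤ 0 * B₁.length :=
    sum_map_le fun w hw => (arc_eq_zero.2 (hc w hw)).le
  have b2 : (B₁.map (D.arc y ·)).sum ≤ 1 * B₁.length := sum_map_le fun w _ => arc_le_one _ _
  have b3 : (B₂.map (D.arc · y')).sum ≤ 1 * B₂.length := sum_map_le fun w _ => arc_le_one _ _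
  simp only [List.map_cons, List.sum_cons, List.length_cons, List.sum_map_add, List.map_append,
    List.sum_append, List.length_append, hD.arc_self, arc_eq_zero.2 hyy] at h1 h2 hC
  linarith

theorem OptTheta.exists_right {B₁ B₂ : List V} {y y' : V} (hD : D.Loopless)
    (T : OptTheta D Y K u v M G (B₁ ++ y :: B₂))
    (hy : y ∈ Y) (hn : (y' :: v :: (M ++ u :: (G ++ (B₁ ++ y :: B₂)))).Nodup)
    (hC : ((v :: (M ++ u :: G)).map fun w => D.arc w y + D.arc y' w).sum ≤
      (v :: (M ++ u :: G)).length)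
    (hmid : ∀ w, w ∉ y' :: v :: (M ++ u :: (G ++ (B₁ ++ y :: B₂))) → ¬ (D.Adj y' w ∧ D.Adj w y))
    (hdeg : Fintype.card V ≤ D.outDeg y' + D.inDeg y) (hyy : ¬ D.Adj y' y) :
    ∃ r ∈ B₂, D.Adj y' r := by
  classical
  have T' := T.rev
  rw [List.reverse_append, List.reverse_cons, List.append_assoc, List.singleton_append] at T'
  have := T'.exists_left hD.rev hy (y' := y') ?_ ?_ ?_ ?_ hyy
  · simpa using this
  · rw [List.nodup_iff_count_le_one] at hn ⊢
    intro x
    have := hn x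
    simp only [List.count_append, List.count_cons, List.count_reverse] at this ⊢
    omega
  · simp only [List.map_cons, List.sum_cons, List.length_cons, List.map_append, List.map_reverse,
      List.sum_append, List.length_append, List.sum_reverse, List.length_reverse, rev_arc] at hC ⊢
    omega
  · intro w hw h
    refine hmid w ?_ ⟨h.2, h.1⟩
    simp at hw ⊢
    tauto
  · rw [outDeg_rev, inDeg_rev]
    omega

theorem OptTheta.false (S : Setting D Y K) (hK : K + 2 ≤ Y.card)
    (T : OptTheta D Y K u v M G B) : False := by
  classical
  obtain ⟨g, P⟩ := T.exists_pivot S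
  obtain ⟨y, hyB, hy⟩ := T.ear_mem
  have huniq := (T.exists_full S P).1
  have hyC := T.not_mem hyB
  obtain ⟨y', hy', hne, hyC'⟩ : ∃ y' ∈ Y, y ≠ y' ∧ y' ∉ v :: (M ++ u :: G) := by
    obtain ⟨a, ha, b, hb, hab, haC, hbC⟩ := exists_two_off (L := v :: (M ++ u :: G)) (Y := Y)
      (by rw [T.yc_eq]; exact hK)
    by_cases h : y = a
    · exact ⟨b, hb, by rwa [h], hbC⟩
    · exact ⟨a, ha, h, haC⟩
  have hyB' : y' ∉ B := fun hm => hne (huniq y hyB hy y' hm hy')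
  have hyall : y' ∉ v :: (M ++ u :: (G ++ B)) := by
    simp at hyC' ⊢
    tauto
  have hn : (y' :: v :: (M ++ u :: (G ++ B))).Nodup := List.nodup_cons.2 ⟨hyall, T.nodup⟩
  have hj0 : ¬ D.Adj y y' := T.not_jump S P (J := []) hyB hy hy' hn
  have hj0' : ¬ D.Adj y' y := T.not_jump' S P (J := []) hyB hy hy' hn
  have hmid : ∀ w, w ∉ y' :: v :: (M ++ u :: (G ++ B)) → ¬ (D.Adj y w ∧ D.Adj w y') :=
    fun w hw => T.not_jump S P (J := [w]) hyB hy hy' (List.nodup_cons.2 ⟨hw, hn⟩)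
  have hmid' : ∀ w, w ∉ y' :: v :: (M ++ u :: (G ++ B)) → ¬ (D.Adj y' w ∧ D.Adj w y) :=
    fun w hw => T.not_jump' S P (J := [w]) hyB hy hy' (List.nodup_cons.2 ⟨hw, hn⟩)
  have hb := T.bad S hyB hy P.mem P.memY P.not_ins
  have hgy : y' ≠ g := by
    rintro rfl
    exact hyC' (by simp [P.mem])
  have d0 := hb.le_deg S.a0 hy' hne.symm hgy hj0 hj0'
  have d1 := hb.le_out S.a0 hy' hne.symm hgy hj0
  have d2 := hb.le_in S.a0 hy' hne.symm hgy hj0'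
  have hcyc := T.cyc_gap
  have hL : (y :: y' :: v :: (M ++ u :: G)).Nodup := by
    rw [List.nodup_cons, List.nodup_cons]
    exact ⟨by rw [List.mem_cons]; tauto, hyC', hcyc.2⟩
  have hCC : ∀ w, w ∉ y :: y' :: v :: (M ++ u :: G) → w ∉ v :: (M ++ u :: G) ∧ w ≠ y ∧ w ≠ y' := by
    intro w hw
    simp only [List.mem_cons] at hw ⊢
    tauto
  have e1 := ins_count_closed _ _ (S.no_ins_self hcyc T.yc_eq.ge hy hyC)
  have e2 := ins_count_closed _ _ (S.no_ins_self hcyc T.yc_eq.ge hy' hyC')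
  -- A midpoint `a → w → b` makes `a, w, b` a segment that must not be insertable, which bounds the
  -- opposite sum, of arcs from `b` and into `a`. Conversely, `step` turns a bounded sum of arcs
  -- from `a` and into `b` into a midpoint `a → w → b`. One midpoint, supplied by `hex`, thus yields
  -- both bounds.
  have key : ∀ a ∈ Y, ∀ b, a ∉ v :: (M ++ u :: G) → b ∉ v :: (M ++ u :: G) → a ≠ b →
      (∃ w, w ∉ v :: (M ++ u :: G) ∧ w ≠ a ∧ w ≠ b ∧ D.Adj a w ∧ D.Adj w b) →
      ((v :: (M ++ u :: G)).map fun w => D.arc b w + D.arc w a).sum ≤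
        (v :: (M ++ u :: G)).length := by
    rintro a ha b haC hbC hab ⟨w, hwC, hwa, hwb, h1, h2⟩
    have := ins_count_closed _ _ (S.no_ins (s := a) (t := b) (Z := [a, w, b]) hcyc T.yc_eq.ge
      (fun x z hx hz => ⟨hx, h1, h2, hz⟩)
      (by simp [hwa.symm, hwb, hab]) (by
        intro z hz
        simp only [List.mem_cons, List.not_mem_nil, or_false] at hz
        rcases hz with rfl | rfl | rfl <;> assumption) (by simp : a ∈ _) ha)
    rw [List.sum_map_add]
    linarith
  have hyy := S.loopless.arc_self y
  have hyy' := S.loopless.arc_self y'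
  have z0 := arc_eq_zero.2 hj0
  have z0' := arc_eq_zero.2 hj0'
  have step : ∀ a b, (y :: y' :: v :: (M ++ u :: G)).Perm (a :: b :: v :: (M ++ u :: G)) →
      ¬ D.Adj a b → Fintype.card V ≤ D.outDeg a + D.inDeg b →
      ((v :: (M ++ u :: G)).map fun w => D.arc a w + D.arc w b).sum ≤
        (v :: (M ++ u :: G)).length →
      ∃ w, w ∉ v :: (M ++ u :: G) ∧ w ≠ a ∧ w ≠ b ∧ D.Adj a w ∧ D.Adj w b := by
    intro a b hp hab hdeg hs
    by_contra hc
    have h := sum_univ_le (f := fun w => D.arc a w + D.arc w b) (hp.nodup_iff.1 hL) (c := 1)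
      (fun w hw => arc_add_arc_le_one fun h => hc ⟨w, by
        simp only [List.mem_cons] at hw ⊢
        tauto, fun e => hw (by simp [e]), fun e => hw (by simp [e]), h⟩)
    rw [← out_add_in] at h
    generalize v :: (M ++ u :: G) = C at *
    simp only [List.map_cons, List.sum_cons, List.length_cons, S.loopless.arc_self,
      arc_eq_zero.2 hab] at h
    omega
  have hex : (∃ w, w ∉ v :: (M ++ u :: G) ∧ w ≠ y ∧ w ≠ y' ∧ D.Adj y w ∧ D.Adj w y') ∨
      (∃ w, w ∉ v :: (M ++ u :: G) ∧ w ≠ y' ∧ w ≠ y ∧ D.Adj y' w ∧ D.Adj w y) := by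
    by_contra hc
    have h := sum_univ_le (f := fun w => (D.arc y w + D.arc w y') + (D.arc y' w + D.arc w y)) hL
      (c := 2) (fun w hw => add_le_add
        (arc_add_arc_le_one fun h => hc (Or.inl ⟨w, (hCC w hw).1, (hCC w hw).2.1, (hCC w hw).2.2, h⟩))
        (arc_add_arc_le_one fun h =>
          hc (Or.inr ⟨w, (hCC w hw).1, (hCC w hw).2.2, (hCC w hw).2.1, h⟩)))
    rw [← deg_add_deg] at h
    generalize v :: (M ++ u :: G) = C at *
    simp only [List.map_cons, List.sum_cons, List.length_cons, List.sum_map_add, hyy, hyy', z0,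
      z0'] at h
    linarith
  obtain ⟨f1, f2⟩ : (((v :: (M ++ u :: G)).map fun w => D.arc y w + D.arc w y').sum ≤
        (v :: (M ++ u :: G)).length) ∧
      ((v :: (M ++ u :: G)).map fun w => D.arc y' w + D.arc w y).sum ≤
        (v :: (M ++ u :: G)).length := by
    rcases hex with h | h
    · have f2 := key y hy y' hyC hyC' hne h
      exact ⟨key y' hy' y hyC' hyC hne.symm (step y' y (List.Perm.swap _ _ _) hj0' d2 f2), f2⟩
    · have f1 := key y' hy' y hyC' hyC hne.symm h
      exact ⟨f1, key y hy y' hyC hyC' hne (step y y' (List.Perm.refl _) hj0 d1 f1)⟩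
  obtain ⟨B₁, B₂, rfl⟩ := List.append_of_mem hyB
  obtain ⟨r, hr, hry⟩ := T.exists_left S.loopless hy hn f1 hmid d1 hj0
  obtain ⟨s, hs, hys⟩ := T.exists_right S.loopless hy hn
    (by simpa only [Nat.add_comm] using f2) hmid' d2 hj0'
  obtain ⟨B₁, B₃, rfl⟩ := List.append_of_mem hr
  obtain ⟨B₄, B₂, rfl⟩ := List.append_of_mem hs
  have hear := link_append.1 T.ear
  -- Replacing the part of the ear strictly between `r` and `s`, which contains `y`, by `y'` keeps
  -- the gap and does not lengthen the ear, so minimality persists. Now `y` and `y'` are both bad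
  -- with `g`.
  have T' : OptTheta D Y K u v M G (B₁ ++ r :: y' :: s :: B₂) := by
    refine ⟨⟨T.path, T.gap, link_append.2 ⟨(link_append.1 hear.1).1, hry, hys,
      (link_append.1 hear.2).2⟩, ?_⟩, T.yc_eq, ⟨y', by simp, hy'⟩, fun u' v' M' G' B' h1 h2 h3 => ?_⟩
    · rw [List.nodup_iff_count_le_one] at hn ⊢
      intro x
      have := hn x
      simp only [List.count_append, List.count_cons] at this ⊢
      omega
    · obtain ⟨m1, m2⟩ := T.min _ _ _ _ _ h1 h2 h3
      refine ⟨m1, fun h => ?_⟩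
      have := m2 h
      simp at this ⊢
      omega
  have hb' := T'.bad S (y := y') (by simp) hy' P.mem P.memY P.not_ins
  have := hb.symm.le_deg S.a0 hy' hgy hne.symm hb'.not_adj' hb'.not_adj
  have := hb'.deg_le
  omega

/-- If every cycle misses two vertices of `Y`, then no vertex of `Y` lies on a bypass of a cycle
with the maximum number of vertices of `Y`. -/
theorem Setting.not_bypass (S : Setting D Y K) (hK : K + 2 ≤ Y.card) {a : V} {l : List V}
    (hc : D.Cyc a l) (hl : yc Y (a :: l) = K) {u v : V} (hu : u ∈ a :: l) (hv : v ∈ a :: l)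
    (huv : u ≠ v) {X : List V} (hX : D.Link u X v) (hn : X.Nodup) (hd : ∀ x ∈ X, x ∉ a :: l)
    {y : V} (hyX : y ∈ X) : y ∉ Y := by
  classical
  intro hy
  obtain ⟨M, G, hM, hG, hp⟩ := hc.split hu hv huv
  have hT : Theta D u v M G X := by
    refine ⟨hM, hG, hX, ?_⟩
    have : ((v :: (M ++ u :: G)) ++ X).Nodup :=
      List.nodup_append.2 ⟨hp.nodup_iff.2 hc.2, hn, fun p hp' q hq e =>
        hd q hq (e ▸ hp.mem_iff.1 hp')⟩
    simpa using this
  have hTK : yc Y (v :: (M ++ u :: G)) = K := by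
    rw [← hl]
    exact yc_congr fun t => hp.mem_iff
  -- Two nested uses of `Nat.find` realize the lexicographic minimum.
  let Q : ℕ → ℕ → Prop := fun i j => ∃ u v M G B, Theta D u v M G B ∧
    yc Y (v :: (M ++ u :: G)) = K ∧ (∃ y ∈ B, y ∈ Y) ∧ yc Y G = i ∧ G.length + B.length = j
  have h1 : ∃ i, ∃ j, Q i j := ⟨_, _, u, v, M, G, X, hT, hTK, ⟨y, hyX, hy⟩, rfl, rfl⟩
  have h2 := Nat.find_spec h1
  obtain ⟨u', v', M', G', B', t1, t2, t3, t4, t5⟩ := Nat.find_spec h2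
  refine OptTheta.false (u := u') (v := v') (M := M') (G := G') (B := B') S hK
    ⟨t1, t2, t3, fun u₁ v₁ M₁ G₁ B₁ s1 s2 s3 => ⟨?_, fun he => ?_⟩⟩
  · rw [t4]
    exact Nat.find_min' h1 ⟨_, u₁, v₁, M₁, G₁, B₁, s1, s2, s3, rfl, rfl⟩
  · rw [t5]
    exact Nat.find_min' h2 ⟨u₁, v₁, M₁, G₁, B₁, s1, s2, s3, he.trans t4, rfl⟩

end BypassEnd

/-! ### The case in which no bypass contains a vertex of `Y`. -/

section NoBypass

variable {V : Type*} {D : Digraph V} {Y : Finset V} {K : ℕ} {a : V} {l : List V}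

theorem sum_le_one_of_unique {f : V → ℕ} {L : List V} (hn : L.Nodup) (h1 : ∀ w, f w ≤ 1)
    (hu : ∀ w ∈ L, ∀ w' ∈ L, 0 < f w → 0 < f w' → w = w') : (L.map f).sum ≤ 1 := by
  induction L with
  | nil => simp
  | cons b L ih =>
    have := ih (List.nodup_cons.1 hn).2 (fun w hw w' hw' => hu w (by simp [hw]) w' (by simp [hw']))
    rcases Nat.eq_zero_or_pos (f b) with h | h
    · simpa [h] using this
    · have h0 : (L.map f).sum ≤ 0 * L.length := sum_map_le fun w hw => by
        by_contra hc
        have := hu w (by simp [hw]) b (by simp) (by omega) h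
        subst this
        exact (List.nodup_cons.1 hn).1 hw
      have := h1 b
      simp only [List.map_cons, List.sum_cons]
      omega

theorem nodup_of_length_le_one {J : List V} (h : J.length ≤ 1) : J.Nodup := by
  rcases J with _ | ⟨x, _ | ⟨z, J⟩⟩ <;> simp at h ⊢

theorem Loopless.sum_le (hD : D.Loopless) {x : V} {C : List V} (hx : x ∈ C) :
    (C.map (D.arc x ·)).sum + 1 ≤ C.length ∧ (C.map (D.arc · x)).sum + 1 ≤ C.length := by
  obtain ⟨G₁, G₂, rfl⟩ := List.append_of_mem hx
  have c1 : (G₁.map (D.arc x ·)).sum ≤ 1 * G₁.length := sum_map_le fun w _ => arc_le_one _ _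
  have c2 : (G₁.map (D.arc · x)).sum ≤ 1 * G₁.length := sum_map_le fun w _ => arc_le_one _ _
  have c3 : (G₂.map (D.arc x ·)).sum ≤ 1 * G₂.length := sum_map_le fun w _ => arc_le_one _ _
  have c4 : (G₂.map (D.arc · x)).sum ≤ 1 * G₂.length := sum_map_le fun w _ => arc_le_one _ _
  constructor <;>
  · simp only [List.map_append, List.map_cons, List.sum_append, List.sum_cons, List.length_append,
      List.length_cons, hD.arc_self]
    linarith

variable [Fintype V]

/-- `a :: l` is a cycle with the maximum number `K` of vertices of `Y`, it misses at least two
vertices of `Y`, and contains at least one. -/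
structure MaxCyc (D : Digraph V) (Y : Finset V) (K : ℕ) (a : V) (l : List V) : Prop extends
    Setting D Y K where
  miss : K + 2 ≤ Y.card
  pos : 0 < K
  cyc : D.Cyc a l
  yc_eq : yc Y (a :: l) = K

theorem MaxCyc.rev (T : MaxCyc D Y K a l) : MaxCyc D.rev Y K a l.reverse where
  toSetting := T.toSetting.rev
  miss := T.miss
  pos := T.pos
  cyc := T.cyc.rev
  yc_eq := by rw [← T.yc_eq]; exact yc_congr fun t => by simp

theorem MaxCyc.eq_of_route (T : MaxCyc D Y K a l) {u v y : V} {P Q : List V} (hu : u ∈ a :: l)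
    (hv : v ∈ a :: l) (hy : y ∈ Y) (h1 : D.Link u P y) (h2 : D.Link y Q v)
    (hn : (P ++ y :: Q).Nodup) (hd : ∀ x ∈ P ++ y :: Q, x ∉ a :: l) : u = v := by
  by_contra huv
  exact T.toSetting.not_bypass T.miss T.cyc T.yc_eq hu hv huv (link_append.2 ⟨h1, h2⟩) hn hd
    (y := y) (by simp) hy

theorem MaxCyc.exists_out (T : MaxCyc D Y K a l) {y : V} (hy : y ∈ Y) (hyC : y ∉ a :: l) :
    ∃ A, ∃ v ∈ a :: l, D.Link y A v ∧ (y :: A).Nodup ∧ (∀ w ∈ A, w ∉ a :: l) ∧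
      ∀ A', ∀ v' ∈ a :: l, D.Link y A' v' → A.length ≤ A'.length := by
  classical
  have h1 : 0 < yc Y (a :: l) := by rw [T.yc_eq]; exact T.pos
  obtain ⟨x, hx⟩ := Finset.card_pos.1 (by unfold yc at h1; exact h1)
  rw [Finset.mem_filter] at hx
  exact exists_shortest (S := {w | w ∈ a :: l}) hyC hx.2
    (T.strong y hy x hx.1 (fun e => hyC (e ▸ hx.2)))

theorem MaxCyc.in_unique (T : MaxCyc D Y K a l) {y : V} (hy : y ∈ Y) (hyC : y ∉ a :: l) {c c' : V}
    (hc : c ∈ a :: l) (hc' : c' ∈ a :: l) (h : D.Adj c y) (h' : D.Adj c' y) : c = c' := by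
  obtain ⟨A, v, hv, hA, hn, hoff, -⟩ := T.exists_out hy hyC
  have key : ∀ c ∈ a :: l, D.Adj c y → c = v := fun c hc h =>
    T.eq_of_route (P := []) hc hv hy h hA hn (by
      intro x hx
      rcases List.mem_cons.1 hx with rfl | hx
      · exact hyC
      · exact hoff x hx)
  rw [key c hc h, key c' hc' h']

theorem MaxCyc.out_unique (T : MaxCyc D Y K a l) {y : V} (hy : y ∈ Y) (hyC : y ∉ a :: l) {c c' : V}
    (hc : c ∈ a :: l) (hc' : c' ∈ a :: l) (h : D.Adj y c) (h' : D.Adj y c') : c = c' :=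
  T.rev.in_unique hy (by simpa using hyC) (by simpa using hc) (by simpa using hc') h h'

theorem MaxCyc.sum_in (T : MaxCyc D Y K a l) {y : V} (hy : y ∈ Y) (hyC : y ∉ a :: l) :
    ((a :: l).map (D.arc · y)).sum ≤ 1 :=
  sum_le_one_of_unique T.cyc.2 (fun _ => arc_le_one _ _) fun _ hw _ hw' h h' =>
    T.in_unique hy hyC hw hw' (arc_pos.1 h) (arc_pos.1 h')

theorem MaxCyc.sum_out (T : MaxCyc D Y K a l) {y : V} (hy : y ∈ Y) (hyC : y ∉ a :: l) :
    ((a :: l).map (D.arc y ·)).sum ≤ 1 :=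
  sum_le_one_of_unique T.cyc.2 (fun _ => arc_le_one _ _) fun _ hw _ hw' h h' =>
    T.out_unique hy hyC hw hw' (arc_pos.1 h) (arc_pos.1 h')

/-- `b` can be reached from `a'` directly or through a vertex off the list `C` other than `s`. -/
def Short (D : Digraph V) (C : List V) (s a' b : V) : Prop :=
  ∃ J : List V, J.length ≤ 1 ∧ (∀ x ∈ J, x ∉ C ∧ x ≠ s ∧ D.Adj a' x ∧ D.Adj x b) ∧ D.Link a' J b

theorem Setting.short (S : Setting D Y K) {C : List V} {s a' b : V} (hab : a' ≠ b)
    (h : D.Adj a' b ∨ Fintype.card V ≤ D.outDeg a' + D.inDeg b)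
    (hC : ∀ r ∈ C, D.Adj a' r → D.Adj r b → r = s) : D.Short C s a' b := by
  by_cases hadj : D.Adj a' b
  · exact ⟨[], by simp, by simp, hadj⟩
  · obtain ⟨r, hrs, h1, h2⟩ := exists_mid_ne S.loopless hab hadj (h.resolve_left hadj) s
    exact ⟨[r], by simp, by simpa using ⟨fun hm => hrs (hC r (by simpa using hm) h1 h2), hrs, h1, h2⟩,
      h1, h2⟩

/-- A direct or two-step link from `z` to `y`, followed by an arc from `y` to `c`, is a route from
`z` to `c`. -/
theorem MaxCyc.attach_in (T : MaxCyc D Y K a l) {y z : V} (hy : y ∈ Y) (hyC : y ∉ a :: l)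
    (hz : z ∈ a :: l) (h : D.Adj z y ∨ Fintype.card V ≤ D.outDeg z + D.inDeg y) :
    ∀ c ∈ a :: l, D.Adj y c → c = z := by
  intro c hc hyc
  have hzy : z ≠ y := fun e => hyC (e ▸ hz)
  -- Only one vertex of the cycle can have an arc to `y`; a midpoint different from it lies off the
  -- cycle. If there is none, `z` is a dummy value.
  obtain ⟨s, hs⟩ : ∃ s, ∀ r ∈ a :: l, D.Adj r y → r = s := by
    by_cases hex : ∃ s ∈ a :: l, D.Adj s y
    · obtain ⟨s, hs, hsy⟩ := hex
      exact ⟨s, fun r hr hry => T.in_unique hy hyC hr hs hry hsy⟩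
    · exact ⟨z, fun r hr hry => absurd ⟨r, hr, hry⟩ hex⟩
  obtain ⟨J, hJ1, hJ2, hJ⟩ := T.toSetting.short (C := a :: l) hzy h (fun r hr _ h2 => hs r hr h2)
  refine (T.eq_of_route (Q := []) hz hc hy hJ hyc ?_ ?_).symm
  · refine List.nodup_append.2 ⟨nodup_of_length_le_one hJ1, by simp, ?_⟩
    rintro x hx w hw rfl
    rw [List.mem_singleton] at hw
    subst hw
    exact T.loopless _ (hJ2 x hx).2.2.2
  · intro x hx
    rcases List.mem_append.1 hx with hx | hx
    · exact (hJ2 x hx).1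
    · rw [List.mem_singleton] at hx
      rwa [hx]

theorem MaxCyc.attach (T : MaxCyc D Y K a l) {y z : V} (hy : y ∈ Y) (hyC : y ∉ a :: l)
    (hz : z ∈ a :: l) (h : D.Adj z y ∨ Fintype.card V ≤ D.outDeg z + D.inDeg y)
    (h' : D.Adj y z ∨ Fintype.card V ≤ D.outDeg y + D.inDeg z) :
    (∀ c ∈ a :: l, D.Adj y c → c = z) ∧ (∀ c ∈ a :: l, D.Adj c y → c = z) ∧
    ∀ s, D.Short (a :: l) s z y ∧ D.Short (a :: l) s y z := by
  have hzy : z ≠ y := fun e => hyC (e ▸ hz)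
  have h1 := T.attach_in hy hyC hz h
  have h2 : ∀ c ∈ a :: l, D.Adj c y → c = z := by
    have := T.rev.attach_in hy (by simpa using hyC) (z := z) (by simpa using hz)
      (by rwa [outDeg_rev, inDeg_rev, Nat.add_comm])
    simpa using this
  refine ⟨h1, h2, fun s => ⟨T.toSetting.short hzy h fun r hr h3 h4 => ?_,
    T.toSetting.short hzy.symm h' fun r hr h3 h4 => ?_⟩⟩
  · exact absurd h3 (h2 r hr h4 ▸ T.loopless _)
  · exact absurd h4 (h1 r hr h3 ▸ T.loopless _)

/-- Badness links `z` to `y`, `y` to `y'` and `y'` to `x`, each by at most one intermediate vertex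
off the cycle. The freedom to avoid a prescribed midpoint makes these links disjoint, and their
union is a forbidden route from `z` to `x`. -/
theorem MaxCyc.not_bad (T : MaxCyc D Y K a l) {x z y y' : V} (hxC : x ∈ a :: l) (hzC : z ∈ a :: l)
    (hz : z ∈ Y) (hxz : x ≠ z) (hyC : y ∉ a :: l) (hy' : y' ∈ Y) (hyC' : y' ∉ a :: l)
    (hne : y ≠ y') : ¬ D.Bad Y y x := by
  intro hb
  have ne : ∀ {p q : V}, p ∈ a :: l → q ∉ a :: l → p ≠ q := fun hp hq e => hq (e ▸ hp)
  obtain ⟨a1, a2, a3⟩ := T.attach hb.left hyC hzC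
    (or_iff_not_imp_left.2 fun h => hb.le_in T.a0 hz (ne hzC hyC) hxz.symm h)
    (or_iff_not_imp_left.2 fun h => hb.le_out T.a0 hz (ne hzC hyC) hxz.symm h)
  obtain ⟨b1, b2, b3⟩ := T.attach hy' hyC' hxC
    (or_iff_not_imp_left.2 fun h => hb.symm.le_out T.a0 hy' (ne hxC hyC').symm hne.symm h)
    (or_iff_not_imp_left.2 fun h => hb.symm.le_in T.a0 hy' (ne hxC hyC').symm hne.symm h)
  obtain ⟨J₂, p1, p2, p3⟩ := T.toSetting.short (C := a :: l) (s := z) hne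
    (or_iff_not_imp_left.2 fun h => hb.le_out T.a0 hy' hne.symm (ne hxC hyC').symm h)
    (fun r hr h1 _ => a1 r hr h1)
  obtain ⟨J₃, q1, q2, q3⟩ := (b3 z).2
  obtain ⟨t, ht⟩ : ∃ t, ∀ w ∈ J₃, w = t := by
    rcases J₃ with _ | ⟨w, _ | ⟨w', J⟩⟩
    · exact ⟨x, by simp⟩
    · exact ⟨w, by simp⟩
    · simp at q1
  obtain ⟨J₁, r1, r2, r3⟩ := (a3 t).1
  have ll := T.loopless
  -- A common midpoint would shortcut past `y'`: `z` to `y`, then `y → w → x`, where the first link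
  -- is chosen to avoid `w`.
  have d23 : ∀ w ∈ J₂, w ∉ J₃ := by
    intro w h2 h3
    obtain ⟨J, s1, s2, s3⟩ := (a3 w).1
    refine hxz.symm (T.eq_of_route (Q := [w]) hzC hxC hb.left s3 ⟨(p2 w h2).2.2.1, (q2 w h3).2.2.2⟩
      ?_ ?_)
    · refine List.nodup_append.2 ⟨nodup_of_length_le_one s1, ?_, ?_⟩
      · simpa using ll.ne (p2 w h2).2.2.1
      · rintro b hb' c hc rfl
        simp only [List.mem_cons, List.not_mem_nil, or_false] at hc
        rcases hc with rfl | rfl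
        · exact ll _ (s2 _ hb').2.2.2
        · exact (s2 _ hb').2.1 rfl
    · intro b hb'
      simp only [List.mem_append, List.mem_cons, List.not_mem_nil, or_false] at hb'
      rcases hb' with hb' | rfl | rfl
      · exact (s2 _ hb').1
      · exact hyC
      · exact (p2 _ h2).1
  have d12 : ∀ w ∈ J₁, w ∉ J₂ := by
    intro w h1 h2
    obtain ⟨J, s1, s2, s3⟩ := (b3 w).2
    refine hxz.symm (T.eq_of_route (P := [w]) hzC hxC hy' ⟨(r2 w h1).2.2.1, (p2 w h2).2.2.2⟩ s3
      ?_ ?_)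
    · simp only [List.singleton_append, List.nodup_cons, List.mem_cons, not_or]
      exact ⟨⟨ll.ne (p2 w h2).2.2.2, fun h => (s2 _ h).2.1 rfl⟩,
        fun h => ll _ (s2 _ h).2.2.1, nodup_of_length_le_one s1⟩
    · intro b hb'
      simp only [List.mem_append, List.mem_cons, List.not_mem_nil, or_false] at hb'
      rcases hb' with rfl | rfl | hb'
      · exact (p2 _ h2).1
      · exact hyC'
      · exact (s2 _ hb').1
  have y1 : y ∉ J₁ := fun h => ll _ (r2 _ h).2.2.2
  have y2 : y ∉ J₂ := fun h => ll _ (p2 _ h).2.2.1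
  have y3 : y ∉ J₃ := fun h => hb.not_adj (q2 _ h).2.2.2
  have y1' : y' ∉ J₁ := fun h => hxz.symm (b2 z hzC (r2 _ h).2.2.1)
  have y2' : y' ∉ J₂ := fun h => ll _ (p2 _ h).2.2.2
  have y3' : y' ∉ J₃ := fun h => ll _ (q2 _ h).2.2.1
  refine hxz.symm (T.eq_of_route (P := J₁) (Q := J₂ ++ y' :: J₃) hzC hxC hb.left r3
    (link_append.2 ⟨p3, q3⟩) ?_ ?_)
  · refine List.nodup_append.2 ⟨nodup_of_length_le_one r1, List.nodup_cons.2 ⟨?_,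
      List.nodup_append.2 ⟨nodup_of_length_le_one p1, List.nodup_cons.2 ⟨y3',
        nodup_of_length_le_one q1⟩, ?_⟩⟩, ?_⟩
    · simp [y2, y3, hne]
    · rintro w hw w' hw' rfl
      rcases List.mem_cons.1 hw' with rfl | hw'
      · exact y2' hw
      · exact d23 w hw hw'
    · rintro w hw w' hw' rfl
      simp only [List.mem_append, List.mem_cons] at hw'
      rcases hw' with rfl | hw' | rfl | hw'
      · exact y1 hw
      · exact d12 w hw hw'
      · exact y1' hw
      · exact (r2 w hw).2.1 (ht w hw')
  · intro w hw
    simp only [List.mem_append, List.mem_cons] at hw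
    rcases hw with hw | rfl | hw | rfl | hw
    · exact (r2 w hw).1
    · exact hyC
    · exact (p2 w hw).1
    · exact hyC'
    · exact (q2 w hw).1

/-- Otherwise the degree sum is at most `2n - 2`: the arcs from `y` to the cycle and `A` number at
most one, the arcs into `y` from the cycle and into `x` from `A` together at most one, and a walk `x
→ w → y` off both would continue along `A` to `v ≠ x`. -/
theorem MaxCyc.exists_mid_out (T : MaxCyc D Y K a l) {x y v : V} {A : List V} (hy : y ∈ Y)
    (hyC : y ∉ a :: l) (hxC : x ∈ a :: l) (hyx : ¬ D.Adj y x) (hxy : ¬ D.Adj x y)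
    (hdeg : 2 * Fintype.card V ≤ D.deg y + D.deg x + 1)
    (hv : v ∈ a :: l) (hA : D.Link y A v) (hAn : (y :: A).Nodup) (hoff : ∀ w ∈ A, w ∉ a :: l)
    (hmin : ∀ A', ∀ v' ∈ a :: l, D.Link y A' v' → A.length ≤ A'.length) (hxv : x ≠ v) :
    ∃ r, r ∉ a :: l ∧ D.Adj y r ∧ D.Adj r x := by
  by_contra hc
  have hL : (y :: (A ++ (a :: l))).Nodup := by
    have h1 := List.nodup_cons.1 hAn
    refine List.nodup_cons.2 ⟨?_, List.nodup_append.2 ⟨h1.2, T.cyc.2, ?_⟩⟩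
    · rw [List.mem_append]
      tauto
    · rintro p hp q hq rfl
      exact hoff p hp hq
  have hroute : ∀ {c : V} {P : List V}, c ∈ a :: l → D.Link c P y → (P ++ y :: A).Nodup →
      (∀ w ∈ P, w ∉ a :: l) → c = v := fun hcC hP hn hP2 =>
    T.eq_of_route hcC hv hy hP hA hn (by
      intro w hw
      simp only [List.mem_append, List.mem_cons] at hw
      rcases hw with hw | rfl | hw
      · exact hP2 w hw
      · exact hyC
      · exact hoff w hw)
  have hsum := sum_univ_le (f := fun w => (D.arc y w + D.arc w x) + (D.arc x w + D.arc w y)) hL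
    (c := 2) (fun w hw => add_le_add
      (arc_add_arc_le_one fun h => hc ⟨w, by
        simp only [List.mem_cons, List.mem_append] at hw ⊢; tauto, h⟩)
      (arc_add_arc_le_one fun h => hxv (hroute (P := [w]) hxC h
        (List.nodup_cons.2 ⟨fun hm : w ∈ y :: A => hw (by
          simp only [List.mem_cons, List.mem_append] at hm ⊢; tauto), hAn⟩)
        (by simp only [List.mem_cons, List.mem_append] at hw ⊢; simp; tauto))))
  rw [← deg_add_deg] at hsum
  have s1 : ((a :: l).map (D.arc y ·)).sum + (A.map (D.arc y ·)).sum ≤ 1 := by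
    rcases A with _ | ⟨b, A⟩
    · simpa using T.sum_out hy hyC
    · have h0 : ((a :: l).map (D.arc y ·)).sum ≤ 0 * (a :: l).length := sum_map_le fun w hw =>
        (arc_eq_zero.2 fun h => by
          have := hmin [] w hw h
          simp at this).le
      have h1 : ((b :: A).map (D.arc y ·)).sum ≤ 1 := by
        refine sum_map_le_one (fun w => arc_le_one _ _) fun X w Z hX hne => arc_eq_zero.2 fun hw => ?_
        rw [hX] at hmin hA
        have := hmin (w :: Z) v hv ⟨hw, (link_append.1 hA).2⟩
        simp at this
        exact hne this
      omega
  have s2 : ((a :: l).map (D.arc · y)).sum + (A.map (D.arc · x)).sum ≤ 1 := by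
    by_cases hex : ∃ c ∈ a :: l, D.Adj c y
    · obtain ⟨c, hcC, hcy⟩ := hex
      have hcv : c = v := hroute (P := []) hcC hcy hAn (by simp)
      have h0 : (A.map (D.arc · x)).sum ≤ 0 * A.length := sum_map_le fun w hw =>
        (arc_eq_zero.2 fun h => by
          obtain ⟨A₁, A₂, rfl⟩ := List.append_of_mem hw
          refine hxv ((T.eq_of_route (P := []) (Q := A₁ ++ [w]) hcC hxC hy hcy
            (link_append.2 ⟨(link_append.1 hA).1, h⟩) (hAn.sublist (by simp)) ?_).symm.trans hcv)
          intro z hz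
          simp only [List.mem_append, List.mem_cons, List.nil_append, List.not_mem_nil,
            or_false] at hz
          rcases hz with rfl | hz | rfl
          · exact hyC
          · exact hoff z (by simp [hz])
          · exact hoff z (by simp)).le
      have := T.sum_in hy hyC
      omega
    · have h0 : ((a :: l).map (D.arc · y)).sum ≤ 0 * (a :: l).length := sum_map_le fun w hw =>
        (arc_eq_zero.2 fun h => hex ⟨w, hw, h⟩).le
      have h1 : (A.map (D.arc · x)).sum ≤ 1 := by
        refine sum_map_le_one' (fun w => arc_le_one _ _) fun X w Z hX hne => arc_eq_zero.2 fun hw => ?_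
        rw [hX] at hmin hA
        have := hmin (X ++ [w]) x hxC (link_append.2 ⟨(link_append.1 hA).1, hw⟩)
        simp at this
        exact hne this
      omega
  have s3 : (A.map (D.arc x ·)).sum ≤ 1 * A.length := sum_map_le fun w _ => arc_le_one _ _
  have s4 : (A.map (D.arc · y)).sum ≤ 1 * A.length := sum_map_le fun w _ => arc_le_one _ _
  obtain ⟨s5, s6⟩ := T.loopless.sum_le hxC
  generalize a :: l = C at *
  simp only [List.map_cons, List.sum_cons, List.length_cons, List.sum_map_add, List.map_append,
    List.sum_append, List.length_append, T.loopless.arc_self, arc_eq_zero.2 hyx,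
    arc_eq_zero.2 hxy] at hsum
  linarith

theorem MaxCyc.no_in_adj (T : MaxCyc D Y K a l) {y x₁ x₂ : V} (hy : y ∈ Y) (hyC : y ∉ a :: l)
    (hx₁ : x₁ ∈ Y) (hxC₁ : x₁ ∈ a :: l) (hx₂ : x₂ ∈ Y) (hxC₂ : x₂ ∈ a :: l) (hne : x₁ ≠ x₂)
    (hgood : ∀ x ∈ Y, x ∈ a :: l → ¬ D.Adj y x → ¬ D.Adj x y →
      2 * Fintype.card V ≤ D.deg y + D.deg x + 1) {c : V} (hc : c ∈ a :: l) : ¬ D.Adj c y := by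
  intro hcy
  obtain ⟨A, v, hv, hA, hAn, hoff, hmin⟩ := T.exists_out hy hyC
  obtain ⟨x, hx, hxC, hxc⟩ : ∃ x ∈ Y, x ∈ a :: l ∧ x ≠ c := by
    by_cases h : x₁ = c
    · exact ⟨x₂, hx₂, hxC₂, fun e => hne (h.trans e.symm)⟩
    · exact ⟨x₁, hx₁, hxC₁, h⟩
  have hcv : c = v := T.eq_of_route (P := []) hc hv hy hcy hA hAn (by
    intro w hw
    rcases List.mem_cons.1 hw with rfl | hw
    · exact hyC
    · exact hoff w hw)
  have hxy : ¬ D.Adj x y := fun h => hxc (T.in_unique hy hyC hxC hc h hcy)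
  have hyx : ¬ D.Adj y x := fun h => hxc
    (T.eq_of_route (P := []) (Q := []) hc hxC hy hcy h (by simp) (by simpa using hyC)).symm
  obtain ⟨r, hr, h1, h2⟩ := T.exists_mid_out hy hyC hxC hyx hxy (hgood x hx hxC hyx hxy) hv hA hAn
    hoff hmin (hcv ▸ hxc)
  refine hxc (T.eq_of_route (P := []) (Q := [r]) hc hxC hy hcy ⟨h1, h2⟩ ?_ ?_).symm
  · simpa using T.loopless.ne h1
  · intro w hw
    simp only [List.nil_append, List.mem_cons, List.not_mem_nil, or_false] at hw
    rcases hw with rfl | rfl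
    · exact hyC
    · exact hr

/-- Equivalently, at least three two-step walks off the cycle join `x` and `y`, counting both
directions, or two in one direction survive any one exclusion each way; the degree sum would
otherwise be at most `2n - 2`. -/
theorem MaxCyc.exists_mid_ne (T : MaxCyc D Y K a l) {x y : V} (hyC : y ∉ a :: l)
    (hxC : x ∈ a :: l) (hin : ∀ c ∈ a :: l, ¬ D.Adj c y) (hout : ∀ c ∈ a :: l, ¬ D.Adj y c)
    (hdeg : 2 * Fintype.card V ≤ D.deg y + D.deg x + 1) (r s : V) :
    ∃ t, t ∉ a :: l ∧ ((t ≠ r ∧ D.Adj x t ∧ D.Adj t y) ∨ (t ≠ s ∧ D.Adj y t ∧ D.Adj t x)) := by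
  classical
  by_contra hc
  push Not at hc
  have hL : (y :: (a :: l)).Nodup := List.nodup_cons.2 ⟨hyC, T.cyc.2⟩
  let f : V → ℕ := fun w => (D.arc y w + D.arc w x) + (D.arc x w + D.arc w y)
  -- Discounting one unit at each excluded midpoint restores the bound 2 off the cycle. Truncation
  -- is harmless, as only `f` being at most `f'` plus the discounts is used.
  let f' : V → ℕ := fun w => f w - (if w = r then 1 else 0) - (if w = s then 1 else 0)
  have h1 : ∑ w, f w ≤ ∑ w, f' w + 2 := by
    calc ∑ w, f w ≤ ∑ w, (f' w + ((if w = r then 1 else 0) + (if w = s then 1 else 0))) :=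
          Finset.sum_le_sum fun w _ => by simp only [f']; omega
      _ = ∑ w, f' w + 2 := by simp [Finset.sum_add_distrib]
  have h2 := sum_univ_le (f := f') hL (c := 2) (by
    intro w hw
    have hwC : w ∉ a :: l := fun h => hw (by simp [h])
    have b1 : D.arc x w + D.arc w y ≤ 1 + (if w = r then 1 else 0) := by
      split_ifs with h
      · exact add_le_add (arc_le_one _ _) (arc_le_one _ _)
      · exact arc_add_arc_le_one fun h' => (hc w hwC).1 h h'.1 h'.2
    have b2 : D.arc y w + D.arc w x ≤ 1 + (if w = s then 1 else 0) := by
      split_ifs with h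
      · exact add_le_add (arc_le_one _ _) (arc_le_one _ _)
      · exact arc_add_arc_le_one fun h' => (hc w hwC).2 h h'.1 h'.2
    simp only [f', f]
    omega)
  have h3 : ((y :: (a :: l)).map f').sum ≤ ((y :: (a :: l)).map f).sum :=
    List.sum_le_sum fun w _ => by simp only [f']; omega
  have h4 : ∑ w, f w = D.deg y + D.deg x := by rw [deg_add_deg]
  obtain ⟨s5, s6⟩ := T.loopless.sum_le hxC
  have z1 : ((a :: l).map (D.arc · y)).sum ≤ 0 * (a :: l).length := sum_map_le fun w hw =>
    (arc_eq_zero.2 (hin w hw)).le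
  have z2 : ((a :: l).map (D.arc y ·)).sum ≤ 0 * (a :: l).length := sum_map_le fun w hw =>
    (arc_eq_zero.2 (hout w hw)).le
  have hyx := arc_eq_zero.2 (hout x hxC)
  have hxy := arc_eq_zero.2 (hin x hxC)
  generalize a :: l = C at *
  simp only [List.map_cons, List.sum_cons, List.length_cons, List.sum_map_add,
    T.loopless.arc_self, hyx, hxy, f] at h2 h3
  simp only [f] at h1 h4
  linarith

/-- Without bad pairs `y` is nonadjacent to the whole cycle, so all short contact is through
midpoints. The counts supply enough of them for a walk `x → r → y → r' → x'` with `r ≠ r'` and `x ≠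
x'`, a forbidden route. -/
theorem MaxCyc.exists_bad (T : MaxCyc D Y K a l) {y x₁ x₂ : V} (hy : y ∈ Y) (hyC : y ∉ a :: l)
    (hx₁ : x₁ ∈ Y) (hxC₁ : x₁ ∈ a :: l) (hx₂ : x₂ ∈ Y) (hxC₂ : x₂ ∈ a :: l) (hne : x₁ ≠ x₂) :
    ∃ x ∈ Y, x ∈ a :: l ∧ D.Bad Y y x := by
  by_contra hnb
  have hgood : ∀ x ∈ Y, x ∈ a :: l → ¬ D.Adj y x → ¬ D.Adj x y →
      2 * Fintype.card V ≤ D.deg y + D.deg x + 1 := by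
    intro x hx hxC h1 h2
    by_contra hc
    exact hnb ⟨x, hx, hxC, hy, hx, fun e => hyC (e ▸ hxC), h1, h2, by omega⟩
  have hrC : ∀ w, w ∈ a :: l.reverse ↔ w ∈ a :: l := by simp
  have hgood' : ∀ x ∈ Y, x ∈ a :: l.reverse → ¬ D.rev.Adj y x → ¬ D.rev.Adj x y →
      2 * Fintype.card V ≤ D.rev.deg y + D.rev.deg x + 1 := by
    intro x hx hxC h1 h2
    rw [deg_rev, deg_rev]
    exact hgood x hx ((hrC x).1 hxC) h2 h1
  have hyC' : y ∉ a :: l.reverse := fun h => hyC ((hrC y).1 h)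
  have hin : ∀ c ∈ a :: l, ¬ D.Adj c y := fun c hc =>
    T.no_in_adj hy hyC hx₁ hxC₁ hx₂ hxC₂ hne hgood hc
  have hout : ∀ c ∈ a :: l, ¬ D.Adj y c := fun c hc =>
    T.rev.no_in_adj hy hyC' hx₁ ((hrC _).2 hxC₁) hx₂ ((hrC _).2 hxC₂) hne hgood' ((hrC c).2 hc)
  obtain ⟨A, v, hv, hA, hAn, hoff, hmin⟩ := T.exists_out hy hyC
  obtain ⟨A', u, hu, hA', hAn', hoff', hmin'⟩ := T.rev.exists_out hy hyC'
  have mout : ∀ x ∈ Y, x ∈ a :: l → x ≠ v → ∃ r, r ∉ a :: l ∧ D.Adj y r ∧ D.Adj r x :=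
    fun x hx hxC hxv => T.exists_mid_out hy hyC hxC (hout x hxC) (hin x hxC)
      (hgood x hx hxC (hout x hxC) (hin x hxC)) hv hA hAn hoff hmin hxv
  have min : ∀ x ∈ Y, x ∈ a :: l → x ≠ u → ∃ r, r ∉ a :: l ∧ D.Adj x r ∧ D.Adj r y := by
    intro x hx hxC hxu
    obtain ⟨r, hr, h1, h2⟩ := T.rev.exists_mid_out hy hyC' ((hrC x).2 hxC) (hin x hxC) (hout x hxC)
      (hgood' x hx ((hrC x).2 hxC) (hin x hxC) (hout x hxC)) hu hA' hAn' hoff' hmin' hxu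
    exact ⟨r, fun h => hr ((hrC r).2 h), h2, h1⟩
  have mne := fun x (hx : x ∈ Y) hxC => T.exists_mid_ne hyC hxC hin hout
    (hgood x hx hxC (hout x hxC) (hin x hxC))
  have route : ∀ {x x' r r'}, x ∈ a :: l → x' ∈ a :: l → r ∉ a :: l → r' ∉ a :: l → r ≠ r' →
      D.Adj x r → D.Adj r y → D.Adj y r' → D.Adj r' x' → x = x' := by
    intro x x' r r' hx hx' hr hr' hrr h1 h2 h3 h4
    refine T.eq_of_route (P := [r]) (Q := [r']) hx hx' hy ⟨h1, h2⟩ ⟨h3, h4⟩ ?_ ?_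
    · have := T.loopless.ne h2
      have := T.loopless.ne h3
      simp [*]
    · intro w hw
      simp only [List.mem_append, List.mem_cons, List.not_mem_nil, or_false] at hw
      rcases hw with rfl | rfl | rfl <;> assumption
  have main : ∀ x₁ ∈ Y, x₁ ∈ a :: l → ∀ x₂ ∈ Y, x₂ ∈ a :: l → x₁ ≠ x₂ → x₁ ≠ u → False := by
    intro x₁ hx₁ hxC₁ x₂ hx₂ hxC₂ hne hxu
    obtain ⟨r₁, hr₁, c1, c2⟩ := min x₁ hx₁ hxC₁ hxu
    -- Returning from `y` to `x₂` is possible only through `r₁`, so excluding `r₁` on that side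
    -- forces a midpoint from `x₂` to `y` that avoids any given `r`.
    have two : ∀ r, ∃ t, t ∉ a :: l ∧ t ≠ r ∧ D.Adj x₂ t ∧ D.Adj t y := by
      intro r
      obtain ⟨t, ht, h | h⟩ := mne x₂ hx₂ hxC₂ r r₁
      · exact ⟨t, ht, h⟩
      · exact absurd (route hxC₁ hxC₂ hr₁ ht h.1.symm c1 c2 h.2.1 h.2.2) hne
    have hno : ∀ t, t ∉ a :: l → D.Adj y t → ¬ D.Adj t x₁ := by
      intro t ht h1 h2
      obtain ⟨t', ht', htt, h3, h4⟩ := two t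
      exact hne (route hxC₂ hxC₁ ht' ht htt h3 h4 h1 h2).symm
    have hxv : x₁ = v := by
      by_contra h
      obtain ⟨r, hr, h1, h2⟩ := mout x₁ hx₁ hxC₁ h
      exact hno r hr h1 h2
    obtain ⟨r, hr, h1, h2⟩ := mout x₂ hx₂ hxC₂ (hxv ▸ hne.symm)
    obtain ⟨t, ht, h | h⟩ := mne x₁ hx₁ hxC₁ r r
    · exact hne (route hxC₁ hxC₂ ht hr h.1 h.2.1 h.2.2 h1 h2)
    · exact hno t ht h.2.1 h.2.2
  by_cases h : x₁ = u
  · exact main x₂ hx₂ hxC₂ x₁ hx₁ hxC₁ hne.symm (h ▸ hne.symm)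
  · exact main x₁ hx₁ hxC₁ x₂ hx₂ hxC₂ hne h

theorem exists_cyc_missing_one (hD : D.Loopless) (hA : D.ConditionA0 (Y : Set V))
    (hS : D.StronglyConnectedOn (Y : Set V)) (hY : 2 ≤ Y.card) :
    ∃ a l, D.Cyc a l ∧ Y.card ≤ yc Y (a :: l) + 1 := by
  classical
  by_contra hc
  push Not at hc
  obtain ⟨x, hx, y, hy, hxy⟩ := Finset.one_lt_card.1 hY
  obtain ⟨a₀, l₀, hc₀, hx₀⟩ := exists_cyc_one hD hxy (hS x hx y hy hxy) (hS y hy x hx hxy.symm)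
  have h3 : 3 ≤ Y.card := by
    have h1 := hc a₀ l₀ hc₀
    have h2 : ({x} : Finset V).card ≤ yc Y (a₀ :: l₀) := le_yc (by simpa using hx) (by simpa using hx₀)
    rw [Finset.card_singleton] at h2
    omega
  obtain ⟨a₁, l₁, hc₁, h₁⟩ := exists_cyc_two hD hA hS h3
  -- A maximal cycle is obtained by minimizing the number of missed vertices of `Y`.
  have hex : ∃ i, ∃ a l, D.Cyc a l ∧ Y.card - yc Y (a :: l) = i := ⟨_, a₁, l₁, hc₁, rfl⟩
  obtain ⟨a, l, hcl, hl⟩ := Nat.find_spec hex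
  have hmax : ∀ a' l', D.Cyc a' l' → yc Y (a' :: l') ≤ yc Y (a :: l) := by
    intro a' l' h'
    have h1 := Nat.find_min' hex ⟨a', l', h', rfl⟩
    have := hc _ _ h'
    have := hc _ _ hcl
    omega
  have h2 : 2 ≤ yc Y (a :: l) := h₁.trans (hmax _ _ hc₁)
  have hmiss := hc a l hcl
  have T : MaxCyc D Y (yc Y (a :: l)) a l := ⟨⟨hD, hA, hS, hmax⟩, by omega, by omega, hcl, rfl⟩
  obtain ⟨y, hy, y', hy', hne, hyC, hyC'⟩ := exists_two_off (L := a :: l) T.miss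
  obtain ⟨x₁, hx₁, x₂, hx₂, hx⟩ := Finset.one_lt_card.1 (by unfold yc at h2; exact h2)
  rw [Finset.mem_filter] at hx₁ hx₂
  obtain ⟨x, -, hxC, hb⟩ := T.exists_bad hy hyC hx₁.1 hx₁.2 hx₂.1 hx₂.2 hx
  by_cases h : x = x₁
  · exact T.not_bad hxC hx₂.2 hx₂.1 (h ▸ hx) hyC hy' hyC' hne hb
  · exact T.not_bad hxC hx₁.2 hx₁.1 h hyC hy' hyC' hne hb

end NoBypass

/-! ### Sharpness: a vertex joined in both directions to two leaves. -/

section Star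

variable {V : Type*}

/-- The digraph with arcs `z → p`, `p → z`, `z → q`, `q → z`. -/
def star (z p q : V) : Digraph V :=
  ⟨fun i j => (i = z ∧ (j = p ∨ j = q)) ∨ (j = z ∧ (i = p ∨ i = q))⟩

theorem star_loopless {z p q : V} (hp : p ≠ z) (hq : q ≠ z) : (star z p q).Loopless := by
  rintro i (⟨rfl, h | h⟩ | ⟨rfl, h | h⟩) <;> first | exact hp h.symm | exact hq h.symm

theorem star_stronglyConnectedOn (z p q : V) : (star z p q).StronglyConnectedOn {z, p, q} := by
  have h1 : (star z p q).Adj z p := Or.inl ⟨rfl, Or.inl rfl⟩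
  have h2 : (star z p q).Adj z q := Or.inl ⟨rfl, Or.inr rfl⟩
  have h3 : (star z p q).Adj p z := Or.inr ⟨rfl, Or.inl rfl⟩
  have h4 : (star z p q).Adj q z := Or.inr ⟨rfl, Or.inr rfl⟩
  have hz : ∀ x ∈ ({z, p, q} : Set V), Relation.ReflTransGen (star z p q).Adj x z ∧
      Relation.ReflTransGen (star z p q).Adj z x := by
    rintro x (rfl | rfl | rfl)
    · exact ⟨.refl, .refl⟩
    · exact ⟨.single h3, .single h1⟩
    · exact ⟨.single h4, .single h2⟩
  exact fun x hx y hy _ => (hz x hx).1.trans (hz y hy).2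

/-- The only possible nonadjacent pair in the set is that of the leaves, and the third vertex `z` is
joined to both in both directions, so the implications are vacuous. -/
theorem star_conditionA0 [Fintype V] (z p q : V) : (star z p q).ConditionA0 {z, p, q} := by
  have h1 : (star z p q).Adj z p := Or.inl ⟨rfl, Or.inl rfl⟩
  have h2 : (star z p q).Adj z q := Or.inl ⟨rfl, Or.inr rfl⟩
  have h3 : (star z p q).Adj p z := Or.inr ⟨rfl, Or.inl rfl⟩
  have h4 : (star z p q).Adj q z := Or.inr ⟨rfl, Or.inr rfl⟩
  rintro x (rfl | rfl | rfl) y (rfl | rfl | rfl) w (rfl | rfl | rfl) hwx hwy ⟨hxy, hn, hn'⟩ <;>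
    first
    | contradiction
    | exact ⟨fun h => absurd ‹_› h, fun h => absurd ‹_› h⟩

theorem star_not_hasCycleThrough {z p q : V} (hp : p ≠ z) (hq : q ≠ z) (hpq : p ≠ q) :
    ¬ (star z p q).HasCycleThrough {z, p, q} := by
  rintro ⟨c, ⟨-, hn, hch⟩, hc⟩
  have hz := hc z (by simp)
  have hp' := hc p (by simp)
  have hq' := hc q (by simp)
  -- Rotate the cycle to start at `z`. Two further consecutive vertices would need an arc between
  -- them, and every arc uses `z`.
  obtain ⟨l, rfl⟩ : ∃ l : List V, c = ((z :: l : List V) : Cycle V) := by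
    induction c using Quotient.inductionOn' with
    | _ L =>
      obtain ⟨X, Z, rfl⟩ := List.append_of_mem (show z ∈ L from hz)
      exact ⟨Z ++ X, Cycle.coe_eq_coe.2 (List.isRotated_append (l := X) (l' := z :: Z))⟩
  rw [Cycle.chain_coe_cons] at hch
  rw [Cycle.nodup_coe_iff, List.nodup_cons] at hn
  rw [Cycle.mem_coe_iff, List.mem_cons] at hp' hq'
  have hp' := hp'.resolve_left hp
  have hq' := hq'.resolve_left hq
  rcases l with _ | ⟨b, _ | ⟨d, l⟩⟩
  · simp at hp'
  · simp only [List.mem_singleton] at hp' hq'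
    exact hpq (hp'.trans hq'.symm)
  · have h : (star z p q).Adj b d := by
      simp only [List.cons_append, List.isChain_cons_cons] at hch
      exact hch.2.1
    rcases h with h | h <;> exact hn.1 (by simp [h.1])

end Star

end Digraph

theorem mainTheorem1 :
    (∀ (V : Type*) [Fintype V] (D : Digraph V) (Y : Set V),
      D.Loopless → 2 ≤ Y.ncard → D.StronglyConnectedOn Y → D.ConditionA0 Y →
        ∃ v ∈ Y, D.HasCycleThrough (Y \ {v})) ∧
    (∀ n : ℕ, 4 ≤ n → ∃ (D : Digraph (Fin n)) (Y : Set (Fin n)),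
      D.Loopless ∧ 2 ≤ Y.ncard ∧ D.StronglyConnectedOn Y ∧ D.ConditionA0 Y ∧
        ¬ D.HasCycleThrough Y) := by
  classical
  refine ⟨fun V _ D Y hD hY hS hA => ?_, fun n hn => ?_⟩
  · have hYc : (Y.toFinset : Set V) = Y := Set.coe_toFinset Y
    rw [Set.ncard_eq_toFinset_card'] at hY
    obtain ⟨a, l, hc, h⟩ := Digraph.exists_cyc_missing_one (Y := Y.toFinset) hD
      (by rwa [hYc]) (by rwa [hYc]) hY
    have h1 := Finset.card_filter_add_card_filter_not (s := Y.toFinset) (fun x => x ∈ a :: l)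
    have h2 : (Y.toFinset.filter (fun x => x ∉ a :: l)).card ≤ 1 := by
      have : Digraph.yc Y.toFinset (a :: l) = (Y.toFinset.filter (fun x => x ∈ a :: l)).card := by
        unfold Digraph.yc; congr
      omega
    rw [Finset.card_le_one] at h2
    obtain ⟨v, hv, hvY⟩ : ∃ v ∈ Y, ∀ s ∈ Y, s ∉ a :: l → s = v := by
      by_cases hex : ∃ v ∈ Y, v ∉ a :: l
      · obtain ⟨v, hv, hvl⟩ := hex
        exact ⟨v, hv, fun s hs hsl => h2 s (by simpa using ⟨hs, by simpa using hsl⟩) v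
          (by simpa using ⟨hv, by simpa using hvl⟩)⟩
      · obtain ⟨v, hv⟩ := Finset.card_pos.1 (by omega : 0 < Y.toFinset.card)
        exact ⟨v, by simpa using hv, fun s hs hsl => absurd ⟨s, hs, hsl⟩ hex⟩
    refine ⟨v, hv, hc.hasCycleThrough hD fun s hs => ?_⟩
    by_contra hsl
    exact hs.2 (hvY s hs.1 hsl)
  · have h01 : (⟨1, by omega⟩ : Fin n) ≠ ⟨0, by omega⟩ := by simp
    have h02 : (⟨2, by omega⟩ : Fin n) ≠ ⟨0, by omega⟩ := by simp
    have h12 : (⟨1, by omega⟩ : Fin n) ≠ ⟨2, by omega⟩ := by simp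
    refine ⟨Digraph.star ⟨0, by omega⟩ ⟨1, by omega⟩ ⟨2, by omega⟩,
      {⟨0, by omega⟩, ⟨1, by omega⟩, ⟨2, by omega⟩}, Digraph.star_loopless h01 h02, ?_,
      Digraph.star_stronglyConnectedOn _ _ _, Digraph.star_conditionA0 _ _ _,
      Digraph.star_not_hasCycleThrough h01 h02 h12⟩
    exact (Set.ncard_pair h12).symm.trans_le (Set.ncard_le_ncard (by simp) (Set.toFinite _))
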